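/- **Setting.** Let $\|\cdot\|$ be any norm on $\mathbb R^n$, with dual norm $\|g\|_*=\sup_{\|v\|\le 1}\langle g,v\rangle$. Let $X\subset\mathbb R^n$ be nonempty, compact and convex. For $\varphi:X\to\mathbb R$ and $x\in X$ put $\partial\varphi(x)=\{g:\ \varphi(x)+\langle g,y-x\rangle\le\varphi(y)\ \forall y\in X\}$. Let $\xi$ be a random vector in $\mathbb R^d$, let $F,H:X\times\mathbb R^d\to\mathbb R$ be such that $F(x,\xi)$ and $H(x,\xi)$ are integrable for every $x\in X$, and put $f(x)=\mathbb E[F(x,\xi)]$, $h(x)=\mathbb E[H(x,\xi)]$. Assume: * $f$ is convex and $\partial f(x)\neq\emptyset$ for all $x\in X$; * $\partial h(x)\ne\emptyset$ for all $x\in X$, and $h$ is strongly convex with parameter $\mu_h>0$: $h(x)+\langle g,y-x\rangle+\frac{\mu_h}{2}\|x-y\|^2\le h(y)$ for all $x,y\in X$ and $g\in\partial h(x)$; * there are jointly measurable maps $g_F,g_H:X\times\mathbb R^d\to\mathbb R^n$ and constants $C_F,C_H>0$ such that for all $x\in X$: almost surely $g_F(x,\xi)\in\partial F(\cdot,\xi)(x)$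 and $g_H(x,\xi)\in\partial H(\cdot,\xi)(x)$; $\mathbb E[g_F(x,\xi)]\in\partial f(x)$ and $\mathbb E[g_H(x,\xi)]\in\partial h(x)$; $\mathbb E\|g_F(x,\xi)\|_*^2\le C_F^2$ and $\mathbb E\|g_H(x,\xi)\|_*^2\le C_H^2$. Let $\omega$ be differentiable on $X$ with, for constants $\mu_\omega>0$ and $L_\omega$ and all $x,y\in X$, $$\tfrac{\mu_\omega}{2}\|x-y\|^2\le D(x,y)\le\tfrac{L_\omega}{2}\|x-y\|^2,\qquad D(x,y)=\omega(y)-\omega(x)-\langle\nabla\omega(x),y-x\rangle ,$$ and let $\mathcal P_X(x,y)=\operatorname{argmin}_{z\in X}\{\langle y,z\rangle+D(x,z)\}$. Let $f^*=\min_X f$. **Algorithm (IR-SMD).** Let $0<\delta<0.5$, $r<1$, $\gamma_0,\lambda_0>0$ with $\gamma_0\lambda_0\le L_\omega/\mu_h$, and for $k\ge0$ $$\gamma_k=\frac{\gamma_0}{(k+1)^{0.5+0.5\delta}},\qquad \lambda_k=\frac{\lambda_0}{(k+1)^{0.5-\delta}} .$$ Let $\xi_0,\tilde\xi_0,\xi_1,\tilde\xi_1,\dots$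 be i.i.d. copies of $\xi$, and let $x_0$ be a random point of $X$ independent of them. For $k\ge 0$ put $$x_{k+1}=\mathcal P_X\bigl(x_k,\ \gamma_k(g_F(x_k,\xi_k)+\lambda_k\,g_H(x_k,\tilde\xi_k))\bigr),$$ and, with $\bar x_0=x_0$ and $S_0=\gamma_0^r$, $$S_{k+1}=S_k+\gamma_{k+1}^r,\qquad \bar x_{k+1}=\frac{S_k\bar x_k+\gamma_{k+1}^r x_{k+1}}{S_{k+1}} .$$ **Theorem.** The bilevel problem of minimizing $h$ over $\operatorname{argmin}_X f$ has exactly one solution $x_h^*$, and 1. $\bar x_N\to x_h^*$ almost surely; 2. $\|\bar x_N-x_h^*\|$ is integrable for every $N$ and $\lim_{N\to\infty}\mathbb E\|\bar x_{N+1}-x_h^*\|=0$; 3. $f(\bar x_N)$ is integrable for every $N$ and $\mathbb E[f(\bar x_N)]-f^*=O\bigl(1/N^{0.5-\delta}\bigr)$ as $N\to\infty$. -/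

import Mathlib

open MeasureTheory ProbabilityTheory Filter Topology Asymptotics

noncomputable section

namespace IRSMD

/-! The ambient space `ℝⁿ` with a general norm is a finite-dimensional real normed space `E`.
Subgradients and gradients live in the dual `StrongDual ℝ E`, whose operator norm is the dual norm,
and `g v` is the pairing of `g` with `v`. -/

section Deterministic

variable {E : Type*} [NormedAddCommGroup E] [NormedSpace ℝ E]

/-- The set of subgradients at `x` of a function with domain `X`. -/
def subdifferential (X : Set E) (φ : E → ℝ) (x : E) : Set (StrongDual ℝ E) :=
  {g | ∀ y ∈ X, φ x + g (y - x) ≤ φ y}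

/-- `φ` has a subgradient at every point of its domain `X`. -/
def Subdifferentiable (X : Set E) (φ : E → ℝ) : Prop :=
  ∀ x ∈ X, (subdifferential X φ x).Nonempty

/-- Strong convexity with parameter `μ > 0` with respect to the norm, in subgradient form. -/
def StronglyConvex (X : Set E) (μ : ℝ) (φ : E → ℝ) : Prop :=
  0 < μ ∧ ∀ x ∈ X, ∀ y ∈ X, ∀ g ∈ subdifferential X φ x,
    φ x + g (y - x) + μ / 2 * ‖x - y‖ ^ 2 ≤ φ y

/-- The Bregman distance `D(x, y)` of `w`, where `dw` is the gradient of `w`. -/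
def bregman (w : E → ℝ) (dw : E → StrongDual ℝ E) (x y : E) : ℝ :=
  w y - w x - dw x (y - x)

/-- `w` is a distance generating function on `X` with gradient `dw`, strongly convex with
parameter `μ` and smooth with parameter `L`. -/
structure IsDistanceGenerating (X : Set E) (w : E → ℝ) (dw : E → StrongDual ℝ E)
    (μ L : ℝ) : Prop where
  pos : 0 < μ
  hasGradient : ∀ x ∈ X, HasFDerivWithinAt w (dw x) X x
  lower : ∀ x ∈ X, ∀ y ∈ X, w x + dw x (y - x) + μ / 2 * ‖x - y‖ ^ 2 ≤ w y
  upper : ∀ x ∈ X, ∀ y ∈ X, w y ≤ w x + dw x (y - x) + L / 2 * ‖x - y‖ ^ 2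

/-- `p` is the value at `(x, y)` of the prox mapping: a minimizer over `z ∈ X` of
`⟨y, z⟩ + D(x, z)`. -/
def IsProx (X : Set E) (w : E → ℝ) (dw : E → StrongDual ℝ E) (x : E) (y : StrongDual ℝ E)
    (p : E) : Prop :=
  p ∈ X ∧ IsMinOn (fun z => y z + bregman w dw x z) X p

/-- The solution set of `min f` over `X`. -/
def solutionSet (X : Set E) (f : E → ℝ) : Set E :=
  {x | x ∈ X ∧ IsMinOn f X x}

/-- The solution set of the bilevel problem: minimize `h` over the minimizers of `f` on `X`. -/
def bilevelSolutionSet (X : Set E) (f h : E → ℝ) : Set E :=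
  solutionSet (solutionSet X f) h

/-- The sums `S₀ = γ₀ ^ r`, `S_{k+1} = S_k + γ_{k+1} ^ r`. -/
def weightSum (γ : ℕ → ℝ) (r : ℝ) : ℕ → ℝ
  | 0 => γ 0 ^ r
  | k + 1 => weightSum γ r k + γ (k + 1) ^ r

/-- The averaged iterates of the algorithm, computed recursively from the iterates `x`. -/
def averagedIterate (γ : ℕ → ℝ) (r : ℝ) (x : ℕ → E) : ℕ → E
  | 0 => x 0
  | k + 1 => (weightSum γ r (k + 1))⁻¹ •
      (weightSum γ r k • averagedIterate γ r x k + γ (k + 1) ^ r • x (k + 1))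

end Deterministic

section Stochastic

variable {E : Type*} [NormedAddCommGroup E] [NormedSpace ℝ E] [MeasurableSpace E]
  {S : Type*} [MeasurableSpace S]

/-- The function `x ↦ 𝔼[Φ(x, ξ)]`, where `ν` is the law of `ξ`. -/
def expected (ν : Measure S) (Φ : E → S → ℝ) (x : E) : ℝ :=
  ∫ s, Φ x s ∂ν

/-- `G` is a stochastic subgradient on `X` of the integrand `Φ`: `G(x, ξ)` is almost surely a
subgradient of `Φ(·, ξ)` at `x`, its mean is a subgradient of the expected function at `x`, and
the second moment of its dual norm is at most `C ^ 2`. -/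
structure IsStochasticSubgradient (ν : Measure S) (X : Set E) (Φ : E → S → ℝ)
    (G : E → S → StrongDual ℝ E) (C : ℝ) : Prop where
  pos : 0 < C
  measurable : Measurable (fun p : X × S => G p.1 p.2)
  subgradient : ∀ x ∈ X, ∀ᵐ s ∂ν, G x s ∈ subdifferential X (fun z => Φ z s) x
  mean : ∀ x ∈ X, (∫ s, G x s ∂ν) ∈ subdifferential X (expected ν Φ) x
  integrable : ∀ x ∈ X, Integrable (fun s => ‖G x s‖ ^ 2) ν
  moment : ∀ x ∈ X, ∫ s, ‖G x s‖ ^ 2 ∂ν ≤ C ^ 2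

/-- The standing assumptions on the bilevel problem with `f(x) = 𝔼[F(x, ξ)]`,
`h(x) = 𝔼[H(x, ξ)]`, and stochastic subgradients `GF`, `GH`. -/
structure ProblemAssumptions (ν : Measure S) (X : Set E) (F H : E → S → ℝ)
    (GF GH : E → S → StrongDual ℝ E) (μh CF CH : ℝ) : Prop where
  nonempty : X.Nonempty
  compact : IsCompact X
  convex : Convex ℝ X
  integrable_F : ∀ x ∈ X, Integrable (F x) ν
  integrable_H : ∀ x ∈ X, Integrable (H x) ν
  subdifferentiable_f : Subdifferentiable X (expected ν F)
  convex_f : ConvexOn ℝ X (expected ν F)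
  subdifferentiable_h : Subdifferentiable X (expected ν H)
  stronglyConvex_h : StronglyConvex X μh (expected ν H)
  oracle_F : IsStochasticSubgradient ν X F GF CF
  oracle_H : IsStochasticSubgradient ν X H GH CH

variable {Ω : Type*} [MeasurableSpace Ω]

/-- The samples `ξ_k`, `ξ'_k` (`k ≥ 0`) are i.i.d. with law `ν` and independent of the random
starting point `x₀`. -/
structure SamplingAssumptions (P : Measure Ω) (ν : Measure S) (ξ ξ' : ℕ → Ω → S)
    (x₀ : Ω → E) : Prop where
  measurable_sample : ∀ i : ℕ ⊕ ℕ, Measurable (Sum.elim ξ ξ' i)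
  law : ∀ i : ℕ ⊕ ℕ, P.map (Sum.elim ξ ξ' i) = ν
  indep : iIndepFun (Sum.elim ξ ξ') P
  measurable_init : Measurable x₀
  indep_init : IndepFun x₀ (fun o (i : ℕ ⊕ ℕ) => Sum.elim ξ ξ' i o) P

/-- `x` is a sequence of iterates of the iterative regularized stochastic mirror descent method
with step sizes `γ` and regularization parameters `lam`. -/
structure IsIterates (X : Set E) (w : E → ℝ) (dw : E → StrongDual ℝ E)
    (GF GH : E → S → StrongDual ℝ E) (γ lam : ℕ → ℝ) (ξ ξ' : ℕ → Ω → S)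
    (x : ℕ → Ω → E) : Prop where
  init : ∀ o, x 0 o ∈ X
  step : ∀ k o, IsProx X w dw (x k o)
    (γ k • (GF (x k o) (ξ k o) + lam k • GH (x k o) (ξ' k o))) (x (k + 1) o)

end Stochastic

end IRSMD

end

/-!
Let `z` be the solution of the bilevel problem, which exists and is unique by compactness and the
strong convexity of `h`, and let `y k = D(x k, z)` be the Bregman distance of the iterates to it.
The optimality condition of the prox step (`IsProx.bregman_le`) and the subgradient inequalities
give `IsRun.bregman_succ_le`: up to noise,
`y (k + 1) ≤ y k - γ k * (f (x k) - f z) - γ k * lam k * (h (x k) - h z + μh / 2 * ‖x k - z‖ ^ 2)`.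

*Almost sure convergence.* The quadratic term is at least `(μh / L) * y k`, so it contracts `y` by
the factor `1 - c * γ k * lam k`, and `∑ γ k * lam k` diverges. The remaining terms are at most
`γ k * lam k * ε` as soon as `lam k` is small (`exists_regularized_ge`): where `h` is noticeably
smaller than `h z`, compactness bounds `f - f z` away from zero. The noise is a martingale bounded
in `L²`, because `∑ γ k ^ 2` converges and each sample is independent of the past, plus a series of
squared norms with finite expectation; so its series converges almost surely. A contractive
recursion with a perturbation of this kind tends to zero (`tendsto_zero_of_recursion`). The weights
`γ k ^ r` have divergent sum, so the averages converge to `z` as well, and convergence in mean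
follows by dominated convergence.

*Rate.* In expectation the noise vanishes and `h` is bounded on `X`, so
`γ k * 𝔼[f (x k) - f z]` is at most a telescoping difference plus `O(γ k * lam k + γ k ^ 2)`.
Multiplying by the nondecreasing weights `γ k ^ (r - 1)`, summing by parts and comparing the power
sums gives the rate for the weighted averages of the gaps (`exists_sum_weight_mul_le`), and the
convexity of `f` passes it to the averaged iterates.

Two measurability points need an argument. The prox step is measurable because its objective is
continuous in the minimizing variable, measurable in the data, and has a unique minimizer
(`measurable_argmin`). The gradient `dw` is not assumed measurable, but along feasible directions it
is a limit of difference quotients (`IsDistanceGenerating.measurable_bregman`).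
-/

noncomputable section

namespace IRSMD

/-! ### Power sums -/

/-- With `t = 1 / (n + 1)` and up to the factor `(n + 1) ^ q`, both bounds compare `1 - (1 - t) ^ q`
with `t`: Bernoulli's inequality on one side, monotonicity in the exponent on the other. -/
lemma rpow_sub_rpow_bounds {q : ℝ} (hq : 0 < q) (n : ℕ) :
    min q 1 * ((n : ℝ) + 1) ^ (q - 1) ≤ ((n : ℝ) + 1) ^ q - (n : ℝ) ^ q ∧
      ((n : ℝ) + 1) ^ q - (n : ℝ) ^ q ≤ max q 1 * ((n : ℝ) + 1) ^ (q - 1) := by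
  have hn : (0 : ℝ) < (n : ℝ) + 1 := by positivity
  set t : ℝ := -((n : ℝ) + 1)⁻¹ with ht
  have hinv : ((n : ℝ) + 1)⁻¹ ≤ 1 := inv_le_one_of_one_le₀ (by simp)
  have hinv0 : 0 < ((n : ℝ) + 1)⁻¹ := by positivity
  have ht1 : -1 ≤ t := by rw [ht]; linarith
  have h1t : 0 ≤ 1 + t := by linarith
  have h1t' : 1 + t ≤ 1 := by rw [ht]; linarith
  have hfac : (n : ℝ) = ((n : ℝ) + 1) * (1 + t) := by rw [ht]; field_simp; ring
  have hpow : (n : ℝ) ^ q = ((n : ℝ) + 1) ^ q * (1 + t) ^ q := by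
    conv_lhs => rw [hfac]
    exact Real.mul_rpow hn.le h1t
  have hq1 : ((n : ℝ) + 1) ^ (q - 1) = ((n : ℝ) + 1) ^ q * (-t) := by
    rw [Real.rpow_sub_one hn.ne', ht, neg_neg, div_eq_mul_inv]
  have hP : 0 < ((n : ℝ) + 1) ^ q := by positivity
  suffices h : min q 1 * (-t) ≤ 1 - (1 + t) ^ q ∧ 1 - (1 + t) ^ q ≤ max q 1 * (-t) by
    rw [hpow, hq1]
    constructor <;> nlinarith [h.1, h.2]
  rcases le_total q 1 with h | h
  · rw [min_eq_left h, max_eq_right h]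
    refine ⟨?_, ?_⟩
    · have := rpow_one_add_le_one_add_mul_self ht1 hq.le h
      linarith
    · have := Real.rpow_le_rpow_of_exponent_ge' h1t h1t' hq.le h
      rw [Real.rpow_one] at this
      linarith
  · rw [min_eq_right h, max_eq_left h]
    refine ⟨?_, ?_⟩
    · have := Real.rpow_le_rpow_of_exponent_ge' h1t h1t' zero_le_one h
      rw [Real.rpow_one] at this
      linarith
    · have := one_add_mul_self_le_rpow_one_add ht1 h
      linarith

lemma sum_rpow_bounds {q : ℝ} (hq : 0 < q) (n : ℕ) :
    min q 1 * ∑ k ∈ Finset.range n, ((k : ℝ) + 1) ^ (q - 1) ≤ (n : ℝ) ^ q ∧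
      (n : ℝ) ^ q ≤ max q 1 * ∑ k ∈ Finset.range n, ((k : ℝ) + 1) ^ (q - 1) := by
  induction n with
  | zero => simp [Real.zero_rpow hq.ne']
  | succ n ih =>
    have h := rpow_sub_rpow_bounds hq n
    rw [Finset.sum_range_succ, mul_add, mul_add, Nat.cast_add_one]
    exact ⟨by linarith [h.1, ih.1], by linarith [h.2, ih.2]⟩

lemma tendsto_sum_rpow_atTop {s : ℝ} (hs : s < 1) :
    Tendsto (fun n : ℕ => ∑ k ∈ Finset.range n, ((k : ℝ) + 1) ^ (-s)) atTop atTop := by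
  have hq : 0 < 1 - s := by linarith
  have hm : 0 < max (1 - s) 1 := lt_max_of_lt_left hq
  have h1 : Tendsto (fun n : ℕ => (max (1 - s) 1)⁻¹ * (n : ℝ) ^ (1 - s)) atTop atTop :=
    ((tendsto_rpow_atTop hq).comp tendsto_natCast_atTop_atTop).const_mul_atTop (inv_pos.2 hm)
  refine tendsto_atTop_mono (fun n => ?_) h1
  have h2 := (sum_rpow_bounds hq n).2
  rw [show 1 - s - 1 = -s by ring] at h2
  rw [inv_mul_le_iff₀ hm]
  exact h2

/-! ### Perturbed contractive recursions -/

/-- A recursion `u (k + 1) ≤ (1 - a k) * u k + a k * ε`, for each `ε > 0` from some index on,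
drives `u` below every positive level, because the products of the `1 - a k` vanish. -/
lemma eventually_le_of_recursion {u a : ℕ → ℝ}
    (ha0 : Tendsto a atTop (𝓝 0))
    (hsum : Tendsto (fun n => ∑ k ∈ Finset.range n, a k) atTop atTop)
    (h : ∀ ε > 0, ∀ᶠ k in atTop, u (k + 1) ≤ (1 - a k) * u k + a k * ε) {ε : ℝ} (hε : 0 < ε) :
    ∀ᶠ k in atTop, u k ≤ ε := by
  obtain ⟨N, hN⟩ := eventually_atTop.1
    ((h (ε / 2) (half_pos hε)).and (ha0.eventually (ge_mem_nhds one_pos)))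
  set A : ℕ → ℝ := fun n => ∑ k ∈ Finset.range n, a k with hA
  set c : ℝ := max (u N - ε / 2) 0 * Real.exp (A N) with hc
  have hc0 : 0 ≤ c := by positivity
  have key : ∀ n, N ≤ n → u n - ε / 2 ≤ c * Real.exp (-A n) := by
    intro n hn
    induction n, hn using Nat.le_induction with
    | base =>
      rw [hc, mul_assoc, ← Real.exp_add, add_neg_cancel, Real.exp_zero, mul_one]
      exact le_max_left _ _
    | succ n hn ih =>
      obtain ⟨h1, h2⟩ := hN n hn
      have hAn : A (n + 1) = A n + a n := Finset.sum_range_succ _ _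
      calc u (n + 1) - ε / 2 ≤ (1 - a n) * (u n - ε / 2) := by linarith
        _ ≤ (1 - a n) * (c * Real.exp (-A n)) :=
            mul_le_mul_of_nonneg_left ih (by linarith)
        _ ≤ Real.exp (-a n) * (c * Real.exp (-A n)) := by
            refine mul_le_mul_of_nonneg_right ?_ (by positivity)
            linarith [Real.add_one_le_exp (-a n)]
        _ = c * Real.exp (-A (n + 1)) := by
            rw [hAn, neg_add, Real.exp_add]; ring
  have hlim : Tendsto (fun n => c * Real.exp (-A n)) atTop (𝓝 (c * 0)) :=
    (Real.tendsto_exp_neg_atTop_nhds_zero.comp hsum).const_mul c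
  rw [mul_zero] at hlim
  filter_upwards [hlim.eventually (ge_mem_nhds (half_pos hε)), eventually_ge_atTop N] with n h1 h2
  linarith [key n h2]

/-- The recursion of `eventually_le_of_recursion` tolerates perturbations `e k` whose series
converges, even conditionally: they are absorbed by adding the tail of the series to `y`. -/
lemma tendsto_zero_of_recursion {y a e : ℕ → ℝ} {l : ℝ} (hy : ∀ k, 0 ≤ y k) (ha : ∀ k, 0 ≤ a k)
    (ha0 : Tendsto a atTop (𝓝 0))
    (hsum : Tendsto (fun n => ∑ k ∈ Finset.range n, a k) atTop atTop)
    (he : Tendsto (fun n => ∑ k ∈ Finset.range n, e k) atTop (𝓝 l))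
    (h : ∀ ε > 0, ∀ᶠ k in atTop, y (k + 1) ≤ (1 - a k) * y k + a k * ε + e k) :
    Tendsto y atTop (𝓝 0) := by
  set R : ℕ → ℝ := fun n => l - ∑ k ∈ Finset.range n, e k with hR
  have hR0 : Tendsto R atTop (𝓝 0) := by simpa using he.const_sub l
  have hRs : ∀ k, R (k + 1) = R k - e k := fun k => by
    simp only [hR, Finset.sum_range_succ]; ring
  have hu : ∀ ε > 0, ∀ᶠ k in atTop,
      y (k + 1) + R (k + 1) ≤ (1 - a k) * (y k + R k) + a k * ε := by
    intro ε hε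
    filter_upwards [h (ε / 2) (half_pos hε), hR0.eventually (ge_mem_nhds (half_pos hε))]
      with k h1 h2
    rw [hRs]
    nlinarith [mul_le_mul_of_nonneg_left h2 (ha k)]
  rw [Metric.tendsto_atTop']
  intro ε hε
  have h3 := eventually_le_of_recursion (u := fun k => y k + R k) ha0 hsum hu
    (show 0 < ε / 3 by positivity)
  obtain ⟨N, hN⟩ := eventually_atTop.1
    (h3.and (hR0.eventually (lt_mem_nhds (show -(ε / 3) < 0 by linarith))))
  refine ⟨N, fun n hn => ?_⟩
  obtain ⟨h4, h5⟩ := hN n hn.le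
  rw [Real.dist_0_eq_abs, abs_of_nonneg (hy n)]
  linarith

/-! ### Convergence rate of weighted averages -/

/-- Summation by parts against nondecreasing weights. -/
lemma sum_mul_sub_le {c d : ℕ → ℝ} {M : ℝ} (hc : Monotone c) (hd : ∀ k, d k ≤ M)
    (hc0 : 0 ≤ c 0) (n : ℕ) :
    ∑ k ∈ Finset.range (n + 1), c k * (d k - d (k + 1)) ≤ c n * M - c n * d (n + 1) := by
  induction n with
  | zero => simp only [zero_add, Finset.sum_range_one]; nlinarith [hd 0]
  | succ n ih =>
    rw [Finset.sum_range_succ]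
    nlinarith [mul_nonneg (sub_nonneg.2 (hc n.le_succ)) (sub_nonneg.2 (hd (n + 1)))]

/-- The averaging argument behind the rate: if the errors `e` obey a telescoping inequality with
steps `(k + 1) ^ (-a)` and bias `(k + 1) ^ (-p)`, their weighted averages decay like
`(n + 1) ^ (-p)`. -/
lemma exists_sum_weight_mul_le {γ lam e d : ℕ → ℝ} {γ₀ lam₀ a p r B C M : ℝ}
    (hγ₀ : 0 < γ₀) (hlam₀ : 0 < lam₀) (ha : 0 < a) (hp0 : 0 ≤ p) (hp : a + p ≤ 1) (hpa : p ≤ a)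
    (hr : r < 1) (hB : 0 ≤ B) (hC : 0 ≤ C)
    (hγ : ∀ k : ℕ, γ k = γ₀ * ((k : ℝ) + 1) ^ (-a))
    (hlam : ∀ k : ℕ, lam k = lam₀ * ((k : ℝ) + 1) ^ (-p))
    (hd0 : ∀ k, 0 ≤ d k) (hdM : ∀ k, d k ≤ M)
    (he : ∀ k, γ k * e k ≤ d k - d (k + 1) + γ k * lam k * B + γ k ^ 2 * C) :
    ∃ K, ∀ n : ℕ, ∑ k ∈ Finset.range (n + 1), γ k ^ r * e k ≤
      K * ((n : ℝ) + 1) ^ (-p) * ∑ k ∈ Finset.range (n + 1), γ k ^ r := by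
  have hM : 0 ≤ M := (hd0 0).trans (hdM 0)
  -- The weight `γ k ^ r` times the bias `(k + 1) ^ (-p)` is of order `(k + 1) ^ (q - 1)`.
  set q : ℝ := 1 - a * r - p with hqdef
  have hq : 0 < q := by nlinarith
  have hqp : 0 < 1 - a * r := by linarith
  have hkpos : ∀ k : ℕ, (0 : ℝ) < (k : ℝ) + 1 := fun k => by positivity
  have hk1 : ∀ k : ℕ, (1 : ℝ) ≤ (k : ℝ) + 1 := fun k => by simp
  have hγpos : ∀ k, 0 < γ k := fun k => by rw [hγ]; have := hkpos k; positivity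
  have hγpow : ∀ (s : ℝ) (k : ℕ), γ k ^ s = γ₀ ^ s * ((k : ℝ) + 1) ^ (-(a * s)) := fun s k => by
    rw [hγ, Real.mul_rpow hγ₀.le (Real.rpow_nonneg (hkpos k).le _), ← Real.rpow_mul (hkpos k).le,
      neg_mul]
  -- Multiplying the telescoping inequality by `γ k ^ (r - 1)`.
  set K₁ : ℝ := lam₀ * B + γ₀ * C with hK₁
  have hK₁0 : 0 ≤ K₁ := by positivity
  have hterm : ∀ k, γ k ^ r * e k ≤ γ k ^ (r - 1) * (d k - d (k + 1)) +
      K₁ * γ₀ ^ r * ((k : ℝ) + 1) ^ (q - 1) := by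
    intro k
    have h1 : γ k ^ r = γ k ^ (r - 1) * γ k := by
      rw [← Real.rpow_add_one (hγpos k).ne', sub_add_cancel]
    have h2 : lam k * B + γ k * C ≤ K₁ * ((k : ℝ) + 1) ^ (-p) := by
      have : ((k : ℝ) + 1) ^ (-a) ≤ ((k : ℝ) + 1) ^ (-p) :=
        Real.rpow_le_rpow_of_exponent_le (hk1 k) (by linarith)
      rw [hlam, hγ, hK₁]
      nlinarith [mul_le_mul_of_nonneg_left this (mul_nonneg hγ₀.le hC)]
    have h3 : ((k : ℝ) + 1) ^ (q - 1) = ((k : ℝ) + 1) ^ (-(a * r)) * ((k : ℝ) + 1) ^ (-p) := by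
      rw [← Real.rpow_add (hkpos k), hqdef]; ring_nf
    calc γ k ^ r * e k = γ k ^ (r - 1) * (γ k * e k) := by rw [h1]; ring
      _ ≤ γ k ^ (r - 1) * (d k - d (k + 1) + γ k * lam k * B + γ k ^ 2 * C) :=
          mul_le_mul_of_nonneg_left (he k) (Real.rpow_nonneg (hγpos k).le _)
      _ = γ k ^ (r - 1) * (d k - d (k + 1)) + γ k ^ r * (lam k * B + γ k * C) := by
          rw [h1]; ring
      _ ≤ γ k ^ (r - 1) * (d k - d (k + 1)) + γ k ^ r * (K₁ * ((k : ℝ) + 1) ^ (-p)) := by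
          have := mul_le_mul_of_nonneg_left h2 (Real.rpow_nonneg (hγpos k).le r)
          linarith
      _ = _ := by rw [hγpow r k, h3]; ring
  have hmono : Monotone fun k => γ k ^ (r - 1) := by
    refine monotone_nat_of_le_succ fun k => ?_
    refine Real.rpow_le_rpow_of_nonpos (hγpos _) ?_ (by linarith)
    rw [hγ, hγ]
    refine mul_le_mul_of_nonneg_left ?_ hγ₀.le
    exact Real.rpow_le_rpow_of_nonpos (hkpos k) (by push_cast; linarith) (by linarith)
  have hm : 0 < min q 1 := lt_min hq one_pos
  have hx : 0 < max (1 - a * r) 1 := lt_max_of_lt_right one_pos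
  have hγr : 0 < γ₀ ^ r := Real.rpow_pos_of_pos hγ₀ r
  have hγr1 : 0 < γ₀ ^ (r - 1) := Real.rpow_pos_of_pos hγ₀ _
  refine ⟨(γ₀ ^ (r - 1) * M + K₁ * γ₀ ^ r * (min q 1)⁻¹) *
    (max (1 - a * r) 1 * (γ₀ ^ r)⁻¹), fun n => ?_⟩
  have hS1 : ∑ k ∈ Finset.range (n + 1), ((k : ℝ) + 1) ^ (q - 1) ≤
      (min q 1)⁻¹ * ((n : ℝ) + 1) ^ q := by
    have := (sum_rpow_bounds hq (n + 1)).1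
    rw [Nat.cast_add_one] at this
    rw [inv_mul_eq_div, le_div_iff₀' hm]
    exact this
  have hS2 : ((n : ℝ) + 1) ^ (1 - a * r) ≤
      max (1 - a * r) 1 * (γ₀ ^ r)⁻¹ * ∑ k ∈ Finset.range (n + 1), γ k ^ r := by
    have := (sum_rpow_bounds hqp (n + 1)).2
    rw [Nat.cast_add_one] at this
    have h2 : ∑ k ∈ Finset.range (n + 1), γ k ^ r =
        γ₀ ^ r * ∑ k ∈ Finset.range (n + 1), ((k : ℝ) + 1) ^ (1 - a * r - 1) := by
      rw [Finset.mul_sum]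
      refine Finset.sum_congr rfl fun k _ => ?_
      rw [hγpow r k]; ring_nf
    rw [h2, mul_assoc, inv_mul_cancel_left₀ hγr.ne']
    exact this
  have hA : ∑ k ∈ Finset.range (n + 1), γ k ^ (r - 1) * (d k - d (k + 1)) ≤
      γ₀ ^ (r - 1) * M * ((n : ℝ) + 1) ^ q := by
    refine (sum_mul_sub_le hmono hdM (Real.rpow_nonneg (hγpos 0).le _) n).trans ?_
    have h1 : 0 ≤ γ n ^ (r - 1) * d (n + 1) :=
      mul_nonneg (Real.rpow_nonneg (hγpos n).le _) (hd0 _)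
    have h2 : ((n : ℝ) + 1) ^ (-(a * (r - 1))) ≤ ((n : ℝ) + 1) ^ q :=
      Real.rpow_le_rpow_of_exponent_le (hk1 n) (by rw [hqdef]; linarith)
    have h3 := mul_le_mul_of_nonneg_left h2 (mul_nonneg hγr1.le hM)
    have h4 := hγpow (r - 1) n
    simp only [h4] at h1 ⊢
    linarith
  have hq' : ((n : ℝ) + 1) ^ q = ((n : ℝ) + 1) ^ (1 - a * r) * ((n : ℝ) + 1) ^ (-p) := by
    rw [← Real.rpow_add (hkpos n), hqdef]; ring_nf
  have hpp : 0 < ((n : ℝ) + 1) ^ (-p) := Real.rpow_pos_of_pos (hkpos n) _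
  calc ∑ k ∈ Finset.range (n + 1), γ k ^ r * e k
      ≤ ∑ k ∈ Finset.range (n + 1), (γ k ^ (r - 1) * (d k - d (k + 1)) +
        K₁ * γ₀ ^ r * ((k : ℝ) + 1) ^ (q - 1)) := Finset.sum_le_sum fun k _ => hterm k
    _ = ∑ k ∈ Finset.range (n + 1), γ k ^ (r - 1) * (d k - d (k + 1)) +
        K₁ * γ₀ ^ r * ∑ k ∈ Finset.range (n + 1), ((k : ℝ) + 1) ^ (q - 1) := by
      rw [Finset.sum_add_distrib, Finset.mul_sum]
    _ ≤ γ₀ ^ (r - 1) * M * ((n : ℝ) + 1) ^ q +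
        K₁ * γ₀ ^ r * ((min q 1)⁻¹ * ((n : ℝ) + 1) ^ q) :=
      add_le_add hA (mul_le_mul_of_nonneg_left hS1 (by positivity))
    _ = (γ₀ ^ (r - 1) * M + K₁ * γ₀ ^ r * (min q 1)⁻¹) * ((n : ℝ) + 1) ^ (-p) *
        ((n : ℝ) + 1) ^ (1 - a * r) := by rw [hq']; ring
    _ ≤ (γ₀ ^ (r - 1) * M + K₁ * γ₀ ^ r * (min q 1)⁻¹) * ((n : ℝ) + 1) ^ (-p) *
        (max (1 - a * r) 1 * (γ₀ ^ r)⁻¹ * ∑ k ∈ Finset.range (n + 1), γ k ^ r) :=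
      mul_le_mul_of_nonneg_left hS2 (by positivity)
    _ = _ := by ring

/-! ### Averaged iterates -/

section Average

variable {E : Type*} [NormedAddCommGroup E] [NormedSpace ℝ E]

lemma weightSum_eq_sum (γ : ℕ → ℝ) (r : ℝ) (n : ℕ) :
    weightSum γ r n = ∑ k ∈ Finset.range (n + 1), γ k ^ r := by
  induction n with
  | zero => simp [weightSum]
  | succ n ih => rw [weightSum, ih, Finset.sum_range_succ _ (n + 1)]

lemma averagedIterate_eq_centerMass {γ : ℕ → ℝ} (hγ : ∀ k, 0 < γ k) (r : ℝ) (x : ℕ → E) (n : ℕ) :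
    averagedIterate γ r x n = (Finset.range (n + 1)).centerMass (fun k => γ k ^ r) x := by
  have hpos : ∀ n, 0 < ∑ k ∈ Finset.range (n + 1), γ k ^ r := fun n =>
    Finset.sum_pos (fun k _ => Real.rpow_pos_of_pos (hγ k) r) (by simp)
  induction n with
  | zero =>
    have := (Real.rpow_pos_of_pos (hγ 0) r).ne'
    simp [averagedIterate, Finset.centerMass, smul_smul, this]
  | succ n ih =>
    rw [averagedIterate, ih, weightSum_eq_sum, weightSum_eq_sum, Finset.centerMass,
      Finset.centerMass, smul_inv_smul₀ (hpos n).ne', Finset.sum_range_succ _ (n + 1),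
      Finset.sum_range_succ _ (n + 1)]

/-- Weighted averages of a convergent sequence, with divergent weights, have the same limit. -/
lemma tendsto_averagedIterate {γ : ℕ → ℝ} (hγ : ∀ k, 0 < γ k) {r : ℝ}
    (hsum : Tendsto (fun n => ∑ k ∈ Finset.range n, γ k ^ r) atTop atTop)
    {x : ℕ → E} {z : E} (hx : Tendsto x atTop (𝓝 z)) :
    Tendsto (averagedIterate γ r x) atTop (𝓝 z) := by
  have hpos : ∀ n, 0 < ∑ k ∈ Finset.range (n + 1), γ k ^ r := fun n =>
    Finset.sum_pos (fun k _ => Real.rpow_pos_of_pos (hγ k) r) (by simp)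
  have h0 : (fun k => γ k ^ r • (x k - z)) =o[atTop] fun k => γ k ^ r := by
    have h1 : (fun k => x k - z) =o[atTop] fun _ => (1 : ℝ) :=
      (isLittleO_one_iff ℝ).2 (by simpa using hx.sub_const z)
    simpa using (isBigO_refl (fun k => γ k ^ r) atTop).smul_isLittleO h1
  have h1 := h0.sum_range (fun k => (Real.rpow_pos_of_pos (hγ k) r).le) hsum
  have h2 : Tendsto (fun n => (∑ k ∈ Finset.range n, γ k ^ r)⁻¹ •
      ∑ k ∈ Finset.range n, γ k ^ r • (x k - z)) atTop (𝓝 0) := by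
    have h3 := (isBigO_refl (fun n => (∑ k ∈ Finset.range n, γ k ^ r)⁻¹) atTop).smul_isLittleO h1
    refine (isLittleO_one_iff ℝ).1 (h3.trans_isBigO ?_)
    refine IsBigO.of_bound 1 (Eventually.of_forall fun n => ?_)
    simp only [smul_eq_mul, one_mul, norm_one]
    by_cases h : ∑ k ∈ Finset.range n, γ k ^ r = 0
    · simp [h]
    · rw [inv_mul_cancel₀ h, norm_one]
  rw [tendsto_iff_norm_sub_tendsto_zero]
  have h4 := ((tendsto_add_atTop_iff_nat 1).2 h2).norm
  rw [norm_zero] at h4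
  refine h4.congr fun n => ?_
  rw [averagedIterate_eq_centerMass hγ, Finset.centerMass]
  simp only [smul_sub, Finset.sum_sub_distrib, ← Finset.sum_smul]
  rw [inv_smul_smul₀ (hpos n).ne']

end Average

section Convexity

/-! ### Subgradients and the bilevel problem -/

variable {E : Type*} [NormedAddCommGroup E]

/-- Near a solution `z` of the bilevel problem, the regularized objective cannot fall below its
value at `z` by more than a vanishing fraction of the regularization parameter. A point where
`h` is smaller than `h z - ε` stays away from the minimizers of `f`, so by compactness `f` exceeds
its minimum there by a fixed amount. -/
lemma exists_regularized_ge {X : Set E} {f h : E → ℝ} {z : E} (hX : IsCompact X)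
    (hf : ContinuousOn f X) (hh : ContinuousOn h X) (hz : z ∈ bilevelSolutionSet X f h)
    {ε : ℝ} (hε : 0 < ε) :
    ∃ Λ > 0, ∀ l, 0 ≤ l → l ≤ Λ → ∀ x ∈ X, -(l * ε) ≤ f x - f z + l * (h x - h z) := by
  have hfz : ∀ x ∈ X, f z ≤ f x := fun x hx => hz.1.2 hx
  have hKcomp : IsCompact (X ∩ {x | h x ≤ h z - ε}) :=
    hX.of_isClosed_subset (hh.preimage_isClosed_of_isClosed hX.isClosed isClosed_Iic)
      Set.inter_subset_left
  rcases (X ∩ {x | h x ≤ h z - ε}).eq_empty_or_nonempty with hK | hK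
  · refine ⟨1, one_pos, fun l hl _ x hx => ?_⟩
    have h1 : h z - ε < h x := by
      by_contra hcon
      exact Set.notMem_empty x (hK ▸ ⟨hx, not_lt.1 hcon⟩)
    nlinarith [hfz x hx, mul_le_mul_of_nonneg_left h1.le hl]
  · obtain ⟨x₁, hx₁, hmin₁⟩ := hKcomp.exists_isMinOn hK (hf.mono Set.inter_subset_left)
    obtain ⟨x₂, hx₂, hmin₂⟩ := hX.exists_isMinOn ⟨z, hz.1.1⟩ hh
    have hpos : 0 < f x₁ - f z := by
      rw [sub_pos]
      refine lt_of_le_of_ne (hfz x₁ hx₁.1) fun heq => ?_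
      have : x₁ ∈ solutionSet X f := ⟨hx₁.1, fun y hy => heq ▸ hfz y hy⟩
      have h1 : h z ≤ h x₁ := hz.2 this
      have h2 : h x₁ ≤ h z - ε := hx₁.2
      linarith
    have hB : 0 ≤ h z - h x₂ := sub_nonneg.2 (hmin₂ hz.1.1)
    refine ⟨(f x₁ - f z) / (h z - h x₂ + 1), by positivity, fun l hl hlΛ x hx => ?_⟩
    rcases lt_or_ge (h z - ε) (h x) with h1 | h1
    · nlinarith [hfz x hx, mul_le_mul_of_nonneg_left h1.le hl]
    · have h2 : f x₁ ≤ f x := hmin₁ ⟨hx, h1⟩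
      have h3 : h x₂ ≤ h x := hmin₂ hx
      rw [le_div_iff₀ (by positivity)] at hlΛ
      nlinarith [mul_le_mul_of_nonneg_left h3 hl, mul_nonneg hl hε.le]

variable [NormedSpace ℝ E]

lemma continuousOn_of_subgradient_bound {X : Set E} {φ : E → ℝ} {C : ℝ}
    (h : ∀ x ∈ X, ∃ g ∈ subdifferential X φ x, ‖g‖ ≤ C) : ContinuousOn φ X := by
  have key : ∀ x ∈ X, ∀ y ∈ X, φ x - φ y ≤ C * dist x y := by
    intro x hx y hy
    obtain ⟨g, hg, hgC⟩ := h x hx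
    have h1 := hg y hy
    have h2 := (le_abs_self _).trans (g.le_opNorm (x - y))
    have h3 : g (y - x) = -g (x - y) := by rw [← map_neg, neg_sub]
    rw [dist_eq_norm]
    nlinarith [mul_le_mul_of_nonneg_right hgC (norm_nonneg (x - y))]
  refine (LipschitzOnWith.of_dist_le_mul (K := C.toNNReal) fun x hx y hy => ?_).continuousOn
  have hC : C * dist x y ≤ C.toNNReal * dist x y :=
    mul_le_mul_of_nonneg_right (Real.le_coe_toNNReal C) dist_nonneg
  rw [Real.dist_eq, abs_sub_le_iff]
  have h2 := key y hy x hx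
  rw [dist_comm] at h2
  exact ⟨(key x hx y hy).trans hC, h2.trans hC⟩

lemma exists_bilevelSolutionSet_eq_singleton {X : Set E} {f h : E → ℝ} {μ : ℝ}
    (hne : X.Nonempty) (hX : IsCompact X) (hf : ContinuousOn f X) (hfc : ConvexOn ℝ X f)
    (hh : ContinuousOn h X) (hsub : Subdifferentiable X h) (hsc : StronglyConvex X μ h) :
    ∃ z, bilevelSolutionSet X f h = {z} := by
  obtain ⟨x₀, hx₀, hmin₀⟩ := hX.exists_isMinOn hne hf
  have hS : solutionSet X f = X ∩ {x | f x ≤ f x₀} := by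
    ext x
    refine ⟨fun hx => ⟨hx.1, hx.2 hx₀⟩, fun hx => ⟨hx.1, fun y hy => ?_⟩⟩
    exact (show f x ≤ f x₀ from hx.2).trans (hmin₀ hy)
  have hScomp : IsCompact (solutionSet X f) := by
    rw [hS]
    exact hX.of_isClosed_subset (hf.preimage_isClosed_of_isClosed hX.isClosed isClosed_Iic)
      Set.inter_subset_left
  have hSconv : Convex ℝ (solutionSet X f) := by
    rw [hS]; exact hfc.convex_le (f x₀)
  obtain ⟨z, hz, hzmin⟩ := hScomp.exists_isMinOn ⟨x₀, hx₀, hmin₀⟩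
    (hh.mono fun x hx => hx.1)
  refine ⟨z, Set.eq_singleton_iff_unique_mem.2 ⟨⟨hz, hzmin⟩, fun y hy => ?_⟩⟩
  -- The midpoint of two solutions would be strictly better than both of them.
  have hm := hSconv hz hy.1 (by norm_num : (0 : ℝ) ≤ 1 / 2) (by norm_num : (0 : ℝ) ≤ 1 / 2)
    (by norm_num)
  set m := (1 / 2 : ℝ) • z + (1 / 2 : ℝ) • y with hmdef
  obtain ⟨g, hg⟩ := hsub m hm.1
  have h1 := hsc.2 m hm.1 z hz.1 g hg
  have h2 := hsc.2 m hm.1 y hy.1.1 g hg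
  have h3 : h z ≤ h m := hzmin hm
  have h4 : h y ≤ h m := hy.2 hm
  have h5 : g (z - m) + g (y - m) = 0 := by
    rw [← map_add, show z - m + (y - m) = 0 by rw [hmdef]; module, map_zero]
  have h6 : ‖m - z‖ ^ 2 ≤ 0 := by
    have := hsc.1
    by_contra hcon
    nlinarith [sq_nonneg ‖m - y‖, mul_pos this (not_le.1 hcon)]
  have h7 : m - z = 0 := by
    rw [← norm_eq_zero]
    exact pow_eq_zero_iff two_ne_zero |>.1 (le_antisymm h6 (sq_nonneg _))
  have h8 : (1 / 2 : ℝ) • (y - z) = 0 := by rw [← h7, hmdef]; module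
  simpa [sub_eq_zero] using h8

/-! ### The prox mapping -/

variable {X : Set E} {w : E → ℝ} {dw : E → StrongDual ℝ E} {μ L : ℝ}

lemma IsDistanceGenerating.le_bregman (hw : IsDistanceGenerating X w dw μ L) {x y : E}
    (hx : x ∈ X) (hy : y ∈ X) : μ / 2 * ‖x - y‖ ^ 2 ≤ bregman w dw x y := by
  have := hw.lower x hx y hy
  rw [bregman]; linarith

lemma IsDistanceGenerating.bregman_le (hw : IsDistanceGenerating X w dw μ L) {x y : E}
    (hx : x ∈ X) (hy : y ∈ X) : bregman w dw x y ≤ L / 2 * ‖x - y‖ ^ 2 := by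
  have := hw.upper x hx y hy
  rw [bregman]; linarith

lemma IsDistanceGenerating.bregman_nonneg (hw : IsDistanceGenerating X w dw μ L) {x y : E}
    (hx : x ∈ X) (hy : y ∈ X) : 0 ≤ bregman w dw x y :=
  le_trans (mul_nonneg (half_pos hw.pos).le (sq_nonneg _)) (hw.le_bregman hx hy)

lemma IsDistanceGenerating.continuousOn (hw : IsDistanceGenerating X w dw μ L) :
    ContinuousOn w X := fun x hx => (hw.hasGradient x hx).continuousWithinAt

/-- The first-order optimality condition of the prox step. -/
lemma IsProx.variational (hw : IsDistanceGenerating X w dw μ L) (hX : Convex ℝ X) {x p z : E}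
    {y : StrongDual ℝ E} (hp : IsProx X w dw x y p) (hz : z ∈ X) :
    0 ≤ y (z - p) + (dw p - dw x) (z - p) := by
  have hd : HasFDerivWithinAt (fun z => y z + bregman w dw x z) (y + (dw p - dw x)) X p := by
    have h1 := (hw.hasGradient p hp.1).sub_const (w x)
    have h2 := ((dw x).hasFDerivWithinAt (s := X) (x := p)).sub_const (dw x x)
    have h3 := (y.hasFDerivWithinAt (s := X) (x := p)).add (h1.sub h2)
    refine h3.congr_of_eventuallyEq (Eventually.of_forall fun v => ?_) ?_ <;>
    simp [bregman, map_sub]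
  exact (hp.2.localize).hasFDerivWithinAt_nonneg hd
    (sub_mem_posTangentConeAt_of_segment_subset (hX.segment_subset hp.1 hz))

/-- The prox objective grows quadratically away from its minimizer. -/
lemma IsProx.quadratic_growth (hw : IsDistanceGenerating X w dw μ L) (hX : Convex ℝ X) {x p z : E}
    {y : StrongDual ℝ E} (hp : IsProx X w dw x y p) (hz : z ∈ X) :
    y p + bregman w dw x p + μ / 2 * ‖p - z‖ ^ 2 ≤ y z + bregman w dw x z := by
  have h1 := hp.variational hw hX hz
  have h2 := hw.lower p hp.1 z hz
  simp only [bregman, map_sub, sub_apply] at *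
  linarith

/-- One mirror descent step: the three-point identity for the Bregman distance, the optimality
condition, and Young's inequality. -/
lemma IsProx.bregman_le (hw : IsDistanceGenerating X w dw μ L) (hX : Convex ℝ X) {x p z : E}
    {y : StrongDual ℝ E} (hp : IsProx X w dw x y p) (hx : x ∈ X) (hz : z ∈ X) :
    bregman w dw p z ≤ bregman w dw x z + y (z - x) + ‖y‖ ^ 2 / (2 * μ) := by
  have h1 := hp.variational hw hX hz
  have h2 := hw.le_bregman hx hp.1
  have h3 : y (x - p) ≤ ‖y‖ ^ 2 / (2 * μ) + μ / 2 * ‖x - p‖ ^ 2 := by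
    have h4 := (le_abs_self _).trans (y.le_opNorm (x - p))
    have h5 : 0 ≤ (‖y‖ - μ * ‖x - p‖) ^ 2 / (2 * μ) := by have := hw.pos; positivity
    have h6 : (‖y‖ - μ * ‖x - p‖) ^ 2 / (2 * μ) =
        ‖y‖ ^ 2 / (2 * μ) - ‖y‖ * ‖x - p‖ + μ / 2 * ‖x - p‖ ^ 2 := by
      have := hw.pos.ne'
      field_simp; ring
    linarith
  simp only [bregman, map_sub, sub_apply] at *
  linarith

end Convexity

/-! ### Measurability of the iterates -/

section Measurability

variable {E : Type*} [NormedAddCommGroup E] [MeasurableSpace E] [BorelSpace E]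
  {Ω : Type*} [MeasurableSpace Ω]

lemma measurable_comp_of_continuousOn {X : Set E} {φ : E → ℝ} (hφ : ContinuousOn φ X)
    {u : Ω → E} (hu : Measurable u) (huX : ∀ o, u o ∈ X) : Measurable fun o => φ (u o) :=
  (continuousOn_iff_continuous_domRestrict.1 hφ).measurable.comp (hu.subtype_mk (h := huX))

/-- The unique minimizer over a compact set of a function that is continuous in the variable and
measurable in the parameter is measurable in the parameter: it lies in a closed set `K` exactly if
the infima over countable dense subsets of `K ∩ X` and of `X` agree. -/
lemma measurable_argmin [SecondCountableTopology E] {X : Set E} (hX : IsCompact X)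
    {ψ : Ω → E → ℝ} (hcont : ∀ o, ContinuousOn (ψ o) X) (hmeas : ∀ z ∈ X, Measurable fun o => ψ o z)
    {p : Ω → E} (hpX : ∀ o, p o ∈ X) (hmin : ∀ o, IsMinOn (ψ o) X (p o))
    (huniq : ∀ o, ∀ z ∈ X, ψ o z ≤ ψ o (p o) → z = p o) : Measurable p := by
  refine measurable_of_isClosed fun K hK => ?_
  have approx : ∀ {D : Set E}, D ⊆ X → ∀ o, ∀ z ∈ X, z ∈ closure D → ∀ c, ψ o z < c →
      ∃ z' ∈ D, ψ o z' < c := by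
    intro D hDX o z hz hzD c hc
    have := mem_closure_iff_nhdsWithin_neBot.1 hzD
    have h1 : ∀ᶠ z' in 𝓝[D] z, ψ o z' < c :=
      ((hcont o z hz).mono hDX).eventually (gt_mem_nhds hc)
    obtain ⟨z', h2, h3⟩ := (h1.and self_mem_nhdsWithin).exists
    exact ⟨z', h3, h2⟩
  obtain ⟨D, hDX, hDc, hXD⟩ :=
    (TopologicalSpace.IsSeparable.of_separableSpace X).exists_countable_dense_subset
  obtain ⟨D', hDX', hDc', hXD'⟩ :=
    (TopologicalSpace.IsSeparable.of_separableSpace (K ∩ X)).exists_countable_dense_subset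
  have hset : p ⁻¹' K = ⋂ n : ℕ, ⋂ z ∈ D, ⋃ z' ∈ D',
      {o | ψ o z' < ψ o z + 1 / ((n : ℝ) + 1)} := by
    ext o
    simp only [Set.mem_preimage, Set.mem_iInter, Set.mem_iUnion, Set.mem_ofPred_eq, exists_prop]
    constructor
    · intro ho n z hz
      refine approx (hDX'.trans Set.inter_subset_right) o (p o) (hpX o) (hXD' ⟨ho, hpX o⟩) _ ?_
      have h1 : ψ o (p o) ≤ ψ o z := hmin o (hDX hz)
      have h2 : (0 : ℝ) < 1 / ((n : ℝ) + 1) := by positivity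
      linarith
    · intro ho
      have hKX : (K ∩ X).Nonempty := by
        obtain ⟨z, hz, -⟩ := approx hDX o (p o) (hpX o) (hXD (hpX o)) _ (lt_add_one _)
        obtain ⟨z', hz', -⟩ := ho 0 z hz
        exact ⟨z', hDX' hz'⟩
      obtain ⟨q, hq, hqmin⟩ := (hX.inter_left hK).exists_isMinOn hKX
        ((hcont o).mono Set.inter_subset_right)
      suffices h : q = p o from h ▸ hq.1
      refine huniq o q hq.2 (le_of_not_gt fun hlt => ?_)
      obtain ⟨z, hz, hzq⟩ := approx hDX o (p o) (hpX o) (hXD (hpX o)) _ hlt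
      obtain ⟨n, hn⟩ := exists_nat_one_div_lt (sub_pos.2 hzq)
      obtain ⟨z', hz', hlt'⟩ := ho n z hz
      have h1 : ψ o q ≤ ψ o z' := hqmin (hDX' hz')
      linarith
  rw [hset]
  refine MeasurableSet.iInter fun n => MeasurableSet.biInter hDc fun z hz =>
    MeasurableSet.biUnion hDc' fun z' hz' => ?_
  exact measurableSet_lt (hmeas z' (hDX' hz').2) ((hmeas z (hDX hz)).add_const _)

variable [NormedSpace ℝ E] {X : Set E} {w : E → ℝ} {dw : E → StrongDual ℝ E} {μ L : ℝ}

/-- Along feasible directions the gradient is a pointwise limit of difference quotients, hence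
measurable, although the within-`X` gradient itself need not be. -/
lemma IsDistanceGenerating.measurable_bregman [SecondCountableTopology E]
    (hw : IsDistanceGenerating X w dw μ L)
    (hX : Convex ℝ X) {u : Ω → E} (hu : Measurable u) (huX : ∀ o, u o ∈ X) {z : E} (hz : z ∈ X) :
    Measurable fun o => bregman w dw (u o) z := by
  have hwu := measurable_comp_of_continuousOn hw.continuousOn hu huX
  suffices h : Measurable fun o => dw (u o) (z - u o) from (measurable_const.sub hwu).sub h
  have ht : ∀ n : ℕ, ∀ o, u o + (1 / ((n : ℝ) + 1)) • (z - u o) ∈ X := fun n o =>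
    hX.add_smul_sub_mem (huX o) hz ⟨by positivity, by
      rw [div_le_one (by positivity)]; simp⟩
  refine measurable_of_tendsto_metrizable (f := fun (n : ℕ) o =>
    ((n : ℝ) + 1) * (w (u o + (1 / ((n : ℝ) + 1)) • (z - u o)) - w (u o)))
    (fun n => ?_) (tendsto_pi_nhds.2 fun o => ?_)
  · refine ((measurable_comp_of_continuousOn hw.continuousOn ?_ (ht n)).sub hwu).const_mul _
    exact hu.add ((measurable_const.sub hu).const_smul _)
  · have := (hw.hasGradient (u o) (huX o)).lim (α := ℕ) (l := atTop)
      (c := fun n => (n : ℝ) + 1) (d := fun n => (1 / ((n : ℝ) + 1)) • (z - u o))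
      (v := z - u o) ?_ (Eventually.of_forall fun n => ht n o) ?_
    · simpa using this
    · simpa using (tendsto_one_div_add_atTop_nhds_zero_nat (𝕜 := ℝ)).smul_const (z - u o)
    · refine tendsto_const_nhds.congr fun n => ?_
      rw [smul_smul, mul_one_div_cancel (by positivity), one_smul]

lemma measurable_prox [SecondCountableTopology E] (hw : IsDistanceGenerating X w dw μ L)
    (hXc : IsCompact X) (hX : Convex ℝ X)
    {u p : Ω → E} {y : Ω → StrongDual ℝ E} (hu : Measurable u) (huX : ∀ o, u o ∈ X)
    (hy : Measurable y) (hp : ∀ o, IsProx X w dw (u o) (y o) (p o)) : Measurable p := by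
  refine measurable_argmin hXc (ψ := fun o z => y o z + bregman w dw (u o) z) (fun o => ?_)
    (fun z hz => ?_) (fun o => (hp o).1) (fun o => (hp o).2) (fun o z hz hle => ?_)
  · refine (y o).continuous.continuousOn.add ((hw.continuousOn.sub continuousOn_const).sub ?_)
    exact ((dw (u o)).continuous.comp (continuous_id.sub continuous_const)).continuousOn
  · exact (hy.apply_continuousLinearMap z).add (hw.measurable_bregman hX hu huX hz)
  · have h1 := (hp o).quadratic_growth hw hX hz
    have h2 : ‖p o - z‖ ^ 2 ≤ 0 := by
      by_contra hcon
      nlinarith [mul_pos hw.pos (not_le.1 hcon)]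
    have h3 : ‖p o - z‖ = 0 := pow_eq_zero_iff two_ne_zero |>.1 (le_antisymm h2 (sq_nonneg _))
    exact (sub_eq_zero.1 (norm_eq_zero.1 h3)).symm

end Measurability

/-! ### The history of the algorithm -/

section History

variable {Ω : Type*} [mΩ : MeasurableSpace Ω] {P : Measure Ω}
  {S : Type*} [MeasurableSpace S] {T : Type*} [MeasurableSpace T]

/-- Adjoining to an independent family a random variable that is independent of the whole family
gives an independent family, with the new variable at index `none`. -/
lemma iIndep_option {ι : Type*} {u : Ω → T} {ζ : ι → Ω → S}
    (hζ : iIndepFun ζ P) (hu : IndepFun u (fun o i => ζ i o) P) :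
    iIndep (fun i : Option ι => i.elim (MeasurableSpace.comap u inferInstance)
      fun j => MeasurableSpace.comap (ζ j) inferInstance) P := by
  classical
  rw [iIndep_iff]
  intro s f hf
  have hall : ∀ i : ι, some i ∈ s → MeasurableSet[MeasurableSpace.comap (ζ i) inferInstance]
      (f (some i)) := fun i hi => hf (some i) hi
  have hprod : P (⋂ i ∈ s.eraseNone, f (some i)) = ∏ i ∈ s.eraseNone, P (f (some i)) :=
    (iIndep_iff _ _).1 hζ _ fun i hi => hall i (Finset.mem_eraseNone.1 hi)
  by_cases hs : none ∈ s
  · have hs' : s = Finset.insertNone s.eraseNone := by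
      rw [Finset.insertNone_eraseNone, Finset.insert_eq_of_mem hs]
    have hset : ⋂ i ∈ s, f i = f none ∩ ⋂ i ∈ s.eraseNone, f (some i) := by
      ext o
      simp [Option.forall, hs]
    have hmeas : MeasurableSet[MeasurableSpace.comap (fun o i => ζ i o) inferInstance]
        (⋂ i ∈ s.eraseNone, f (some i)) := by
      refine Finset.measurableSet_biInter _ fun i hi => ?_
      obtain ⟨B, hB, hB'⟩ := hall i (Finset.mem_eraseNone.1 hi)
      exact ⟨(fun z : ι → S => z i) ⁻¹' B, measurable_pi_apply i hB, hB'⟩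
    rw [hset, (Indep_iff _ _ _).1 hu _ _ (hf none hs) hmeas, hprod]
    conv_rhs => rw [hs']
    rw [Finset.prod_insertNone]
  · have hs' : s = s.eraseNone.map Function.Embedding.some := by
      rw [Finset.map_some_eraseNone, Finset.erase_eq_of_notMem hs]
    have hset : ⋂ i ∈ s, f i = ⋂ i ∈ s.eraseNone, f (some i) := by
      ext o
      simp [Option.forall, hs]
    rw [hset, hprod]
    conv_rhs => rw [hs']
    rw [Finset.prod_map]
    rfl

/-- The indices of the random variables that determine the `k`-th iterate: the starting point
(index `none`) and the samples drawn before step `k`. -/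
def pastIndices (k : ℕ) : Set (Option (ℕ ⊕ ℕ)) :=
  {i | ∀ j, i = some (Sum.inl j) ∨ i = some (Sum.inr j) → j < k}

/-- The `σ`-algebra generated by the starting point or by a single sample. -/
@[reducible]
def sourceSigma (u : Ω → T) (ζ : ℕ ⊕ ℕ → Ω → S) : Option (ℕ ⊕ ℕ) → MeasurableSpace Ω :=
  fun i => i.elim (MeasurableSpace.comap u inferInstance)
    fun j => MeasurableSpace.comap (ζ j) inferInstance

lemma sourceSigma_le {u : Ω → T} {ζ : ℕ ⊕ ℕ → Ω → S} (hu : Measurable u)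
    (hζ : ∀ i, Measurable (ζ i)) (i : Option (ℕ ⊕ ℕ)) : sourceSigma u ζ i ≤ mΩ := by
  cases i with
  | none => exact hu.comap_le
  | some i => exact (hζ i).comap_le

/-- The filtration generated by the starting point and the samples drawn before step `k`. -/
def history {u : Ω → T} {ζ : ℕ ⊕ ℕ → Ω → S} (hu : Measurable u)
    (hζ : ∀ i, Measurable (ζ i)) : Filtration ℕ mΩ where
  seq k := ⨆ i ∈ pastIndices k, sourceSigma u ζ i
  mono' _ _ hkl := biSup_mono fun _ hi j hj => (hi j hj).trans_le hkl
  le' _ := iSup₂_le fun i _ => sourceSigma_le hu hζ i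

variable {u : Ω → T} {ζ : ℕ ⊕ ℕ → Ω → S} (hu : Measurable u) (hζ : ∀ i, Measurable (ζ i))

lemma measurable_history_init (k : ℕ) : Measurable[history hu hζ k] u := by
  refine Measurable.mono (comap_measurable u) ?_ le_rfl
  exact le_iSup₂_of_le (f := fun i _ => sourceSigma u ζ i) none (by simp [pastIndices]) le_rfl

lemma measurable_history_inl (k : ℕ) : Measurable[history hu hζ (k + 1)] (ζ (Sum.inl k)) := by
  refine Measurable.mono (comap_measurable _) ?_ le_rfl
  exact le_iSup₂_of_le (f := fun i _ => sourceSigma u ζ i) (some (Sum.inl k))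
    (by simp [pastIndices]) le_rfl

lemma measurable_history_inr (k : ℕ) : Measurable[history hu hζ (k + 1)] (ζ (Sum.inr k)) := by
  refine Measurable.mono (comap_measurable _) ?_ le_rfl
  exact le_iSup₂_of_le (f := fun i _ => sourceSigma u ζ i) (some (Sum.inr k))
    (by simp [pastIndices]) le_rfl

lemma indep_history (hind : iIndepFun ζ P) (hindu : IndepFun u (fun o i => ζ i o) P)
    (k : ℕ) {i : ℕ ⊕ ℕ} (hi : i = Sum.inl k ∨ i = Sum.inr k) :
    Indep (history hu hζ k) (MeasurableSpace.comap (ζ i) inferInstance) P := by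
  have h := indep_iSup_of_disjoint (sourceSigma_le hu hζ) (iIndep_option hind hindu)
    (S := pastIndices k) (T := {some i}) (by
      rw [Set.disjoint_singleton_right]
      rintro h
      rcases hi with rfl | rfl
      · exact lt_irrefl _ (h k (Or.inl rfl))
      · exact lt_irrefl _ (h k (Or.inr rfl)))
  rw [iSup_singleton] at h
  exact h

end History

/-! ### Sampling independently of the past -/

section Sampling

variable {Ω : Type*} [mΩ : MeasurableSpace Ω] {P : Measure Ω}
  {S : Type*} [MeasurableSpace S] {ν : Measure S} {T : Type*} [MeasurableSpace T]

/-- A sample `ζ k` is drawn at step `k`, independently of the past and with law `ν`. -/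
structure IsFreshSample (P : Measure Ω) (ν : Measure S) (ℱ : Filtration ℕ mΩ)
    (ζ : ℕ → Ω → S) : Prop where
  measurable : ∀ k, Measurable[ℱ (k + 1)] (ζ k)
  law : ∀ k, P.map (ζ k) = ν
  indep : ∀ k, Indep (ℱ k) (MeasurableSpace.comap (ζ k) inferInstance) P

lemma IsFreshSample.measurable_top {ℱ : Filtration ℕ mΩ} {ζ : ℕ → Ω → S}
    (hζ : IsFreshSample P ν ℱ ζ) (k : ℕ) : Measurable (ζ k) :=
  (hζ.measurable k).mono (ℱ.le _) le_rfl

lemma IsFreshSample.indepFun {ℱ : Filtration ℕ mΩ} {ζ : ℕ → Ω → S}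
    (hζ : IsFreshSample P ν ℱ ζ) {k : ℕ}
    {Z : Ω → T} (hZ : Measurable[ℱ k] Z) : IndepFun Z (ζ k) P :=
  indep_of_indep_of_le_left (hζ.indep k) (@Measurable.comap_le _ _ (ℱ k) _ _ hZ)

variable [IsProbabilityMeasure P]

lemma map_prodMk_eq {Z : Ω → T} {ζ : Ω → S} (hZ : Measurable Z) (hζ : Measurable ζ)
    (hlaw : P.map ζ = ν) (hind : IndepFun Z ζ P) :
    P.map (fun o => (Z o, ζ o)) = (P.map Z).prod ν := by
  rw [← hlaw]
  exact (indepFun_iff_map_prod_eq_prod_map_map hZ.aemeasurable hζ.aemeasurable).1 hind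

variable [IsProbabilityMeasure ν]

/-- Moment bounds that hold at each fixed point persist along a random point that is independent
of the sample. -/
lemma integrable_comp_sample {Z : Ω → T} {ζ : Ω → S} (hZ : Measurable Z) (hζ : Measurable ζ)
    (hlaw : P.map ζ = ν) (hind : IndepFun Z ζ P) {φ : T × S → ℝ} (hφ : Measurable φ)
    (hφ0 : ∀ p, 0 ≤ φ p) (hint : ∀ t, Integrable (fun s => φ (t, s)) ν) {K : ℝ}
    (hK : ∀ t, ∫ s, φ (t, s) ∂ν ≤ K) :
    Integrable (fun o => φ (Z o, ζ o)) P ∧ ∫ o, φ (Z o, ζ o) ∂P ≤ K := by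
  have hbound : ∫⁻ o, ENNReal.ofReal (φ (Z o, ζ o)) ∂P ≤ ENNReal.ofReal K := by
    have h1 : ∫⁻ o, ENNReal.ofReal (φ (Z o, ζ o)) ∂P =
        ∫⁻ p, ENNReal.ofReal (φ p) ∂((P.map Z).prod ν) := by
      rw [← map_prodMk_eq hZ hζ hlaw hind,
        lintegral_map hφ.ennreal_ofReal (hZ.prodMk hζ)]
    rw [h1, lintegral_prod _ hφ.ennreal_ofReal.aemeasurable]
    have := Measure.isProbabilityMeasure_map (μ := P) hZ.aemeasurable
    calc ∫⁻ t, ∫⁻ s, ENNReal.ofReal (φ (t, s)) ∂ν ∂(P.map Z)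
        ≤ ∫⁻ _, ENNReal.ofReal K ∂(P.map Z) := lintegral_mono fun t => by
          rw [← ofReal_integral_eq_lintegral_ofReal (hint t) (Eventually.of_forall fun s => hφ0 _)]
          exact ENNReal.ofReal_le_ofReal (hK t)
      _ = ENNReal.ofReal K := by simp
  have hK0 : 0 ≤ K := by
    have : Nonempty Ω := nonempty_of_isProbabilityMeasure P
    exact (integral_nonneg fun s => hφ0 (Z this.some, s)).trans (hK _)
  have hI : Integrable (fun o => φ (Z o, ζ o)) P := by
    refine ⟨(hφ.comp (hZ.prodMk hζ)).aestronglyMeasurable, ?_⟩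
    rw [hasFiniteIntegral_iff_ofReal (Eventually.of_forall fun o => hφ0 _)]
    exact hbound.trans_lt ENNReal.ofReal_lt_top
  refine ⟨hI, ?_⟩
  rw [← ofReal_integral_eq_lintegral_ofReal hI (Eventually.of_forall fun o => hφ0 _)] at hbound
  exact (ENNReal.ofReal_le_ofReal_iff hK0).1 hbound

/-- A function with mean zero in the sample at every fixed point is orthogonal to every variable
`B` of the past. -/
lemma integral_mul_centered_eq_zero {Z : Ω → T} {B : Ω → ℝ} {ζ : Ω → S} (hZ : Measurable Z)
    (hB : Measurable B) (hζ : Measurable ζ) (hlaw : P.map ζ = ν)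
    (hind : IndepFun (fun o => (Z o, B o)) ζ P) {φ : T × S → ℝ} (hφ : Measurable φ)
    (h0 : ∀ t, ∫ s, φ (t, s) ∂ν = 0) :
    ∫ o, B o * φ (Z o, ζ o) ∂P = 0 := by
  by_cases hint : Integrable (fun o => B o * φ (Z o, ζ o)) P
  swap
  · exact integral_undef hint
  have hm : Measurable fun p : (T × ℝ) × S => p.1.2 * φ (p.1.1, p.2) :=
    measurable_fst.snd.mul (hφ.comp (measurable_fst.fst.prodMk measurable_snd))
  have hmap := map_prodMk_eq (hZ.prodMk hB) hζ hlaw hind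
  have hmeas : Measurable fun o => ((Z o, B o), ζ o) := (hZ.prodMk hB).prodMk hζ
  have h1 : ∫ o, B o * φ (Z o, ζ o) ∂P =
      ∫ p, p.1.2 * φ (p.1.1, p.2) ∂((P.map fun o => (Z o, B o)).prod ν) := by
    rw [← hmap, integral_map hmeas.aemeasurable hm.aestronglyMeasurable]
  have h2 : Integrable (fun p : (T × ℝ) × S => p.1.2 * φ (p.1.1, p.2))
      ((P.map fun o => (Z o, B o)).prod ν) := by
    rw [← hmap, integrable_map_measure hm.aestronglyMeasurable hmeas.aemeasurable]
    exact hint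
  have := Measure.isProbabilityMeasure_map (μ := P) (hZ.prodMk hB).aemeasurable
  rw [h1, integral_prod _ h2]
  simp [integral_const_mul, h0]

variable {ℱ : Filtration ℕ mΩ} {ζ : ℕ → Ω → S} {u : ℕ → Ω → T}

/-- Nonnegative terms with bounded means and summable weights `c k` have a series of finite
expectation, which therefore converges almost surely. -/
lemma IsFreshSample.ae_summable (hζ : IsFreshSample P ν ℱ ζ) (hu : ∀ k, Measurable[ℱ k] (u k))
    {φ : T × S → ℝ} (hφ : Measurable φ) (hφ0 : ∀ p, 0 ≤ φ p)
    (hint : ∀ t, Integrable (fun s => φ (t, s)) ν) {K : ℝ}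
    (hK : ∀ t, ∫ s, φ (t, s) ∂ν ≤ K) {c : ℕ → ℝ} (hc : ∀ k, 0 ≤ c k) (hcs : Summable c) :
    ∀ᵐ o ∂P, Summable fun k => c k * φ (u k o, ζ k o) := by
  have hu' : ∀ k, Measurable (u k) := fun k => (hu k).mono (ℱ.le k) le_rfl
  have hb := fun k => integrable_comp_sample (hu' k) (hζ.measurable_top k) (hζ.law k)
    (hζ.indepFun (hu k)) hφ hφ0 hint hK
  have hmeas : ∀ k, Measurable fun o => ENNReal.ofReal (c k * φ (u k o, ζ k o)) := fun k =>
    ((hφ.comp ((hu' k).prodMk (hζ.measurable_top k))).const_mul _).ennreal_ofReal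
  have hfin : ∫⁻ o, ∑' k, ENNReal.ofReal (c k * φ (u k o, ζ k o)) ∂P ≠ ⊤ := by
    rw [lintegral_tsum fun k => (hmeas k).aemeasurable]
    refine ne_top_of_le_ne_top ?_ (ENNReal.tsum_le_tsum (g := fun k => ENNReal.ofReal (c k * K))
      fun k => ?_)
    · exact (hcs.mul_right K).tsum_ofReal_ne_top
    · rw [← ofReal_integral_eq_lintegral_ofReal ((hb k).1.const_mul _)
        (Eventually.of_forall fun o => mul_nonneg (hc k) (hφ0 _)), integral_const_mul]
      exact ENNReal.ofReal_le_ofReal (mul_le_mul_of_nonneg_left (hb k).2 (hc k))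
  filter_upwards [ae_lt_top (Measurable.tsum hmeas) hfin] with o ho
  have := ENNReal.summable_toReal ho.ne
  refine this.congr fun k => ?_
  rw [ENNReal.toReal_ofReal (mul_nonneg (hc k) (hφ0 _))]

lemma IsFreshSample.memLp (hζ : IsFreshSample P ν ℱ ζ) (hu : ∀ k, Measurable[ℱ k] (u k))
    {φ : T × S → ℝ} (hφ : Measurable φ)
    (hint : ∀ t, Integrable (fun s => φ (t, s) ^ 2) ν) {K : ℝ}
    (hK : ∀ t, ∫ s, φ (t, s) ^ 2 ∂ν ≤ K) (k : ℕ) :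
    MemLp (fun o => φ (u k o, ζ k o)) 2 P ∧ ∫ o, φ (u k o, ζ k o) ^ 2 ∂P ≤ K := by
  have hu' : Measurable (u k) := (hu k).mono (ℱ.le k) le_rfl
  have hb := integrable_comp_sample hu' (hζ.measurable_top k) (hζ.law k)
    (hζ.indepFun (hu k)) (hφ.pow_const 2) (fun p => sq_nonneg _) hint hK
  refine ⟨?_, hb.2⟩
  exact (memLp_two_iff_integrable_sq
    (hφ.comp (hu'.prodMk (hζ.measurable_top k))).aestronglyMeasurable).2 hb.1

/-- The weighted series of the noise is a martingale bounded in `L²`, since its increments are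
orthogonal, so it converges almost surely. -/
lemma IsFreshSample.ae_tendsto_sum (hζ : IsFreshSample P ν ℱ ζ) (hu : ∀ k, Measurable[ℱ k] (u k))
    {φ : T × S → ℝ} (hφ : Measurable φ) (h0 : ∀ t, ∫ s, φ (t, s) ∂ν = 0)
    (hint : ∀ t, Integrable (fun s => φ (t, s) ^ 2) ν) {K : ℝ}
    (hK : ∀ t, ∫ s, φ (t, s) ^ 2 ∂ν ≤ K) {c : ℕ → ℝ} (hcs : Summable fun k => c k ^ 2) :
    ∀ᵐ o ∂P, ∃ l, Tendsto (fun n => ∑ k ∈ Finset.range n, c k * φ (u k o, ζ k o))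
      atTop (𝓝 l) := by
  have hu' : ∀ k, Measurable (u k) := fun k => (hu k).mono (ℱ.le k) le_rfl
  set M : ℕ → Ω → ℝ := fun n o => ∑ k ∈ Finset.range n, c k * φ (u k o, ζ k o) with hM
  have hMs : ∀ n o, M (n + 1) o = M n o + c n * φ (u n o, ζ n o) := fun n o =>
    Finset.sum_range_succ _ _
  have hL2 := fun k => hζ.memLp hu hφ hint hK k
  have hMad : ∀ n, Measurable[ℱ n] (M n) := fun n => by
    refine Finset.measurable_sum _ fun k hk => ?_
    have hkn := Finset.mem_range.1 hk
    refine Measurable.const_mul (hφ.comp (Measurable.prodMk ?_ ?_)) _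
    · exact (hu k).mono (ℱ.mono hkn.le) le_rfl
    · exact (hζ.measurable k).mono (ℱ.mono hkn) le_rfl
  have hML2 : ∀ n, MemLp (M n) 2 P := fun n =>
    memLp_finsetSum _ fun k _ => (hL2 k).1.const_mul (c k)
  have horth : ∀ n (B : Ω → ℝ), Measurable[ℱ n] B → ∫ o, B o * φ (u n o, ζ n o) ∂P = 0 :=
    fun n B hB => integral_mul_centered_eq_zero (hu' n) (hB.mono (ℱ.le n) le_rfl)
      (hζ.measurable_top n) (hζ.law n) (hζ.indepFun ((hu n).prodMk hB)) hφ h0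
  have hφI : ∀ k, Integrable (fun o => φ (u k o, ζ k o)) P := fun k =>
    (hL2 k).1.integrable one_le_two
  have hMI : ∀ n, Integrable (M n) P := fun n => (hML2 n).integrable one_le_two
  have hmart : Martingale M ℱ P := by
    refine martingale_of_setIntegral_eq_succ (fun n => (hMad n).stronglyMeasurable) hMI
      fun n A hA => ?_
    simp only [hMs]
    rw [integral_add (hMI n).integrableOn ((hφI n).const_mul _).integrableOn, integral_const_mul,
      left_eq_add, ← integral_indicator (ℱ.le n A hA)]
    -- Orthogonality to the indicators of past events is the martingale property.
    have h1 := horth n (A.indicator 1) ((@measurable_const ℝ Ω _ (ℱ n) 1).indicator hA)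
    rw [show (fun o => A.indicator (1 : Ω → ℝ) o * φ (u n o, ζ n o)) =
      A.indicator fun o => φ (u n o, ζ n o) from ?_] at h1
    · rw [h1, mul_zero]
    · ext o
      by_cases ho : o ∈ A <;> simp [ho]
  have hsq : ∀ n, ∫ o, M n o ^ 2 ∂P ≤ ∑ k ∈ Finset.range n, c k ^ 2 * K := by
    intro n
    induction n with
    | zero => simp [hM]
    | succ n ih =>
      have e : ∀ o, M (n + 1) o ^ 2 = M n o ^ 2 + 2 * c n * (M n o * φ (u n o, ζ n o)) +
          c n ^ 2 * φ (u n o, ζ n o) ^ 2 := fun o => by rw [hMs]; ring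
      have i1 : Integrable (fun o => M n o ^ 2) P := (hML2 n).integrable_sq
      have i2 : Integrable (fun o => 2 * c n * (M n o * φ (u n o, ζ n o))) P :=
        ((hML2 n).integrable_mul (hL2 n).1).const_mul _
      have i3 : Integrable (fun o => c n ^ 2 * φ (u n o, ζ n o) ^ 2) P :=
        (hL2 n).1.integrable_sq.const_mul _
      simp only [e]
      rw [integral_add (f := fun o => M n o ^ 2 + 2 * c n * (M n o * φ (u n o, ζ n o)))
        (i1.add i2) i3, integral_add i1 i2, integral_const_mul, integral_const_mul,
        horth n _ (hMad n), mul_zero, add_zero, Finset.sum_range_succ]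
      exact add_le_add ih (mul_le_mul_of_nonneg_left (hL2 n).2 (sq_nonneg _))
  have hK0 : 0 ≤ K := (integral_nonneg fun o => sq_nonneg _).trans (hL2 0).2
  refine hmart.submartingale.exists_ae_tendsto_of_bdd
    (R := (1 + (∑' k, c k ^ 2) * K).toNNReal) fun n => ?_
  rw [eLpNorm_one_eq_lintegral_enorm, ← ofReal_integral_norm_eq_lintegral_enorm (hMI n)]
  refine ENNReal.ofReal_le_ofReal ?_
  -- A bound in `L¹` follows from the one in `L²` by `|m| ≤ 1 + m ^ 2`.
  have h1 : ∫ o, ‖M n o‖ ∂P ≤ ∫ o, (1 + M n o ^ 2) ∂P := by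
    refine integral_mono (hMI n).norm ((integrable_const 1).add (hML2 n).integrable_sq) fun o => ?_
    change ‖M n o‖ ≤ 1 + M n o ^ 2
    rw [Real.norm_eq_abs, ← sq_abs]
    nlinarith [sq_nonneg (|M n o| - 1), abs_nonneg (M n o)]
  rw [integral_add (integrable_const 1) (hML2 n).integrable_sq] at h1
  have h2 : ∑ k ∈ Finset.range n, c k ^ 2 * K ≤ (∑' k, c k ^ 2) * K := by
    rw [← Finset.sum_mul]
    exact mul_le_mul_of_nonneg_right (hcs.sum_le_tsum _ fun k _ => sq_nonneg _) hK0
  simp only [integral_const, probReal_univ, smul_eq_mul, mul_one] at h1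
  linarith [hsq n]

end Sampling

/-! ### Stochastic subgradients -/

lemma exists_norm_sub_le {E : Type*} [NormedAddCommGroup E] {X : Set E} (hX : IsCompact X) (z : E) :
    ∃ R, ∀ x ∈ X, ‖z - x‖ ≤ R :=
  (hX.exists_bound_of_continuousOn (f := fun x => z - x)
    (continuous_const.sub continuous_id).continuousOn)

section Oracle

variable {E : Type*} [NormedAddCommGroup E] [NormedSpace ℝ E]
  [MeasurableSpace E] {S : Type*} [MeasurableSpace S] {ν : Measure S}
  {X : Set E} {Φ : E → S → ℝ} {G : E → S → StrongDual ℝ E} {C : ℝ}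

/-- The deviation of the stochastic subgradient at `p.1` from its mean, evaluated in the direction
of `z`. -/
def noise (ν : Measure S) (G : E → S → StrongDual ℝ E) (z : E) (p : X × S) : ℝ :=
  G p.1 p.2 (z - p.1) - (∫ s, G p.1 s ∂ν) (z - p.1)

namespace IsStochasticSubgradient

lemma measurable_apply (hG : IsStochasticSubgradient ν X Φ G C) (x : X) :
    Measurable (G x) :=
  hG.measurable.comp (measurable_const.prodMk measurable_id)

variable [FiniteDimensional ℝ E]

lemma integrable_apply [IsProbabilityMeasure ν] (hG : IsStochasticSubgradient ν X Φ G C)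
    (x : X) : Integrable (G x) ν :=
  ((memLp_two_iff_integrable_sq_norm (hG.measurable_apply x).aestronglyMeasurable).2
    (hG.integrable x x.2)).integrable one_le_two

/-- The mean has norm at most `C`, by `‖g‖ ≤ (‖g‖ ^ 2 / C + C) / 2`. -/
lemma norm_mean_le [IsProbabilityMeasure ν] (hG : IsStochasticSubgradient ν X Φ G C) (x : X) :
    ‖∫ s, G x s ∂ν‖ ≤ C := by
  have hC := hG.pos
  have h1 : ∫ s, ‖G x s‖ ∂ν ≤ ∫ s, ((2 * C)⁻¹ * ‖G x s‖ ^ 2 + C / 2) ∂ν := by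
    refine integral_mono (hG.integrable_apply x).norm
      (((hG.integrable x x.2).const_mul _).add (integrable_const _)) fun s => ?_
    change ‖G x s‖ ≤ (2 * C)⁻¹ * ‖G x s‖ ^ 2 + C / 2
    have h2 : (2 * C)⁻¹ * ‖G x s‖ ^ 2 + C / 2 - ‖G x s‖ = (2 * C)⁻¹ * (‖G x s‖ - C) ^ 2 := by
      field_simp; ring
    have h3 : 0 ≤ (2 * C)⁻¹ * (‖G x s‖ - C) ^ 2 := by positivity
    linarith
  rw [integral_add ((hG.integrable x x.2).const_mul _) (integrable_const _),
    integral_const_mul] at h1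
  have h4 := mul_le_mul_of_nonneg_left (hG.moment x x.2) (show 0 ≤ (2 * C)⁻¹ by positivity)
  have h5 : (2 * C)⁻¹ * C ^ 2 = C / 2 := by field_simp
  simp only [integral_const, probReal_univ, smul_eq_mul, one_mul] at h1
  linarith [norm_integral_le_integral_norm (μ := ν) (G x)]

lemma continuousOn_expected [IsProbabilityMeasure ν] (hG : IsStochasticSubgradient ν X Φ G C) :
    ContinuousOn (expected ν Φ) X :=
  continuousOn_of_subgradient_bound fun x hx => ⟨_, hG.mean x hx, hG.norm_mean_le ⟨x, hx⟩⟩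

lemma integral_noise [IsProbabilityMeasure ν] (hG : IsStochasticSubgradient ν X Φ G C) (z : E)
    (x : X) : ∫ s, noise ν G z (x, s) ∂ν = 0 := by
  have hI := hG.integrable_apply x
  have hI' : Integrable (fun s => G x s (z - x)) ν := hI.apply_continuousLinearMap _
  simp only [noise]
  rw [integral_sub hI' (integrable_const _), ContinuousLinearMap.integral_apply hI]
  simp

lemma measurable_noise [BorelSpace E] [IsProbabilityMeasure ν]
    (hG : IsStochasticSubgradient ν X Φ G C) (z : E) : Measurable (noise (X := X) ν G z) := by
  have h1 : Measurable fun p : X × S => G p.1 p.2 (z - p.1) :=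
    (isBoundedBilinearMap_apply (𝕜 := ℝ) (E := E) (F := ℝ)).continuous.measurable.comp
      (hG.measurable.prodMk (measurable_const.sub (measurable_subtype_coe.comp measurable_fst)))
  have h2 : Measurable fun x : X => ∫ s, G x s (z - x) ∂ν :=
    (h1.stronglyMeasurable.integral_prod_right' (ν := ν)).measurable
  convert h1.sub (h2.comp measurable_fst) using 1
  ext p
  simp [noise, ContinuousLinearMap.integral_apply (hG.integrable_apply p.1)]

lemma noise_sq_le [IsProbabilityMeasure ν] (hG : IsStochasticSubgradient ν X Φ G C) {z : E} {R : ℝ}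
    (hR : ∀ x ∈ X, ‖z - x‖ ≤ R) (x : X) (s : S) :
    noise ν G z (x, s) ^ 2 ≤ 2 * R ^ 2 * ‖G x s‖ ^ 2 + 2 * R ^ 2 * C ^ 2 := by
  have hR0 : 0 ≤ R := (norm_nonneg _).trans (hR x x.2)
  have h1 : |G x s (z - x)| ≤ ‖G x s‖ * R :=
    ((G x s).le_opNorm _).trans (mul_le_mul_of_nonneg_left (hR x x.2) (norm_nonneg _))
  have h2 : |(∫ s, G x s ∂ν) (z - x)| ≤ C * R :=
    ((∫ s, G x s ∂ν).le_opNorm _).trans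
      (mul_le_mul (hG.norm_mean_le x) (hR x x.2) (norm_nonneg _) hG.pos.le)
  have h3 := sq_le_sq' (abs_le.1 h1).1 (abs_le.1 h1).2
  have h4 := sq_le_sq' (abs_le.1 h2).1 (abs_le.1 h2).2
  simp only [noise]
  nlinarith [sq_nonneg (G x s (z - x) + (∫ s, G x s ∂ν) (z - x))]

lemma integrable_noise_sq [BorelSpace E] [IsProbabilityMeasure ν]
    (hG : IsStochasticSubgradient ν X Φ G C) {z : E} {R : ℝ} (hR : ∀ x ∈ X, ‖z - x‖ ≤ R) (x : X) :
    Integrable (fun s => noise ν G z (x, s) ^ 2) ν ∧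
      ∫ s, noise ν G z (x, s) ^ 2 ∂ν ≤ 4 * R ^ 2 * C ^ 2 := by
  have hI : Integrable (fun s => 2 * R ^ 2 * ‖G x s‖ ^ 2 + 2 * R ^ 2 * C ^ 2) ν :=
    ((hG.integrable x x.2).const_mul _).add (integrable_const _)
  have hm : Measurable fun s => noise ν G z (x, s) ^ 2 :=
    ((hG.measurable_noise z).comp (measurable_const.prodMk measurable_id)).pow_const 2
  have hN : Integrable (fun s => noise ν G z (x, s) ^ 2) ν := by
    refine hI.mono' hm.aestronglyMeasurable (Eventually.of_forall fun s => ?_)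
    rw [Real.norm_eq_abs, abs_of_nonneg (sq_nonneg _)]
    exact hG.noise_sq_le hR x s
  refine ⟨hN, ?_⟩
  have h1 := integral_mono hN hI fun s => hG.noise_sq_le hR x s
  rw [integral_add ((hG.integrable x x.2).const_mul _) (integrable_const _),
    integral_const_mul] at h1
  simp only [integral_const, probReal_univ, smul_eq_mul, one_mul] at h1
  nlinarith [mul_le_mul_of_nonneg_left (hG.moment x x.2) (sq_nonneg R)]

end IsStochasticSubgradient

end Oracle

/-! ### Runs of the algorithm -/

section Run

variable {E : Type*} [NormedAddCommGroup E] [NormedSpace ℝ E] [MeasurableSpace E]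
  {S : Type*} [MeasurableSpace S] {Ω : Type*} [MeasurableSpace Ω]
  {P : Measure Ω} {ν : Measure S} {X : Set E} {F H : E → S → ℝ}
  {GF GH : E → S → StrongDual ℝ E} {μh CF CH : ℝ} {w : E → ℝ} {dw : E → StrongDual ℝ E}
  {μw L : ℝ} {γ lam : ℕ → ℝ} {ξ ξ' : ℕ → Ω → S} {x : ℕ → Ω → E} {z : E}

/-- All standing assumptions on a run `x` of the algorithm with step sizes `γ` and regularization
parameters `lam`. -/
structure IsRun (P : Measure Ω) (ν : Measure S) (X : Set E) (F H : E → S → ℝ)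
    (GF GH : E → S → StrongDual ℝ E) (μh CF CH : ℝ) (w : E → ℝ) (dw : E → StrongDual ℝ E)
    (μw L : ℝ) (γ lam : ℕ → ℝ) (ξ ξ' : ℕ → Ω → S) (x : ℕ → Ω → E) : Prop where
  problem : ProblemAssumptions ν X F H GF GH μh CF CH
  generating : IsDistanceGenerating X w dw μw L
  sampling : SamplingAssumptions P ν ξ ξ' (x 0)
  iterates : IsIterates X w dw GF GH γ lam ξ ξ' x

namespace IsRun

lemma mem (hx : IsRun P ν X F H GF GH μh CF CH w dw μw L γ lam ξ ξ' x) (k : ℕ) (o : Ω) :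
    x k o ∈ X := by
  cases k with
  | zero => exact hx.iterates.init o
  | succ k => exact (hx.iterates.step k o).1

lemma fresh_left (hx : IsRun P ν X F H GF GH μh CF CH w dw μw L γ lam ξ ξ' x) :
    IsFreshSample P ν (history hx.sampling.measurable_init hx.sampling.measurable_sample) ξ where
  measurable k := measurable_history_inl hx.sampling.measurable_init
    hx.sampling.measurable_sample k
  law k := hx.sampling.law (Sum.inl k)
  indep k := indep_history _ _ hx.sampling.indep hx.sampling.indep_init k (i := Sum.inl k)
    (Or.inl rfl)

lemma fresh_right (hx : IsRun P ν X F H GF GH μh CF CH w dw μw L γ lam ξ ξ' x) :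
    IsFreshSample P ν (history hx.sampling.measurable_init hx.sampling.measurable_sample) ξ' where
  measurable k := measurable_history_inr hx.sampling.measurable_init
    hx.sampling.measurable_sample k
  law k := hx.sampling.law (Sum.inr k)
  indep k := indep_history _ _ hx.sampling.indep hx.sampling.indep_init k (i := Sum.inr k)
    (Or.inr rfl)

/-- The iterates do not anticipate the samples. -/
lemma measurable_history [FiniteDimensional ℝ E] [BorelSpace E]
    (hx : IsRun P ν X F H GF GH μh CF CH w dw μw L γ lam ξ ξ' x) (k : ℕ) :
    Measurable[history hx.sampling.measurable_init hx.sampling.measurable_sample k] (x k) := by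
  set ℱ := history hx.sampling.measurable_init hx.sampling.measurable_sample
  induction k with
  | zero => exact measurable_history_init _ _ 0
  | succ k ih =>
    have hxk : Measurable[ℱ (k + 1)] (x k) := ih.mono (ℱ.mono k.le_succ) le_rfl
    have hxk' : Measurable[ℱ (k + 1)] fun o => (⟨x k o, hx.mem k o⟩ : X) := hxk.subtype_mk
    have hF : Measurable[ℱ (k + 1)] fun o => GF (x k o) (ξ k o) :=
      hx.problem.oracle_F.measurable.comp (hxk'.prodMk (hx.fresh_left.measurable k))
    have hH : Measurable[ℱ (k + 1)] fun o => GH (x k o) (ξ' k o) :=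
      hx.problem.oracle_H.measurable.comp (hxk'.prodMk (hx.fresh_right.measurable k))
    exact @measurable_prox E _ _ _ Ω (ℱ (k + 1)) _ X w dw μw L _ hx.generating hx.problem.compact
      hx.problem.convex (x k) (x (k + 1)) _ hxk (hx.mem k)
      ((hF.add (hH.const_smul (lam k))).const_smul (γ k)) (hx.iterates.step k)

lemma measurable_subtype [FiniteDimensional ℝ E] [BorelSpace E]
    (hx : IsRun P ν X F H GF GH μh CF CH w dw μw L γ lam ξ ξ' x) (k : ℕ) :
    Measurable[history hx.sampling.measurable_init hx.sampling.measurable_sample k]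
      fun o => (⟨x k o, hx.mem k o⟩ : X) :=
  (hx.measurable_history k).subtype_mk

lemma measurable [FiniteDimensional ℝ E] [BorelSpace E]
    (hx : IsRun P ν X F H GF GH μh CF CH w dw μw L γ lam ξ ξ' x) (k : ℕ) : Measurable (x k) :=
  (hx.measurable_history k).mono (Filtration.le _ k) le_rfl

lemma averagedIterate_mem (hx : IsRun P ν X F H GF GH μh CF CH w dw μw L γ lam ξ ξ' x)
    (hγ : ∀ k, 0 < γ k) (r : ℝ) (n : ℕ) (o : Ω) :
    averagedIterate γ r (fun k => x k o) n ∈ X := by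
  rw [averagedIterate_eq_centerMass hγ]
  exact hx.problem.convex.centerMass_mem (fun k _ => (Real.rpow_pos_of_pos (hγ k) r).le)
    (Finset.sum_pos (fun k _ => Real.rpow_pos_of_pos (hγ k) r) (by simp)) fun k _ => hx.mem k o

lemma measurable_averagedIterate [FiniteDimensional ℝ E] [BorelSpace E]
    (hx : IsRun P ν X F H GF GH μh CF CH w dw μw L γ lam ξ ξ' x) (r : ℝ) (n : ℕ) :
    Measurable fun o => averagedIterate γ r (fun k => x k o) n := by
  induction n with
  | zero => exact hx.measurable 0
  | succ n ih =>
    exact ((ih.const_smul _).add ((hx.measurable (n + 1)).const_smul _)).const_smul _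

lemma integrable_comp [BorelSpace E] [IsProbabilityMeasure P]
    (hx : IsRun P ν X F H GF GH μh CF CH w dw μw L γ lam ξ ξ' x)
    {φ : E → ℝ} (hφ : ContinuousOn φ X) {u : Ω → E} (hu : Measurable u) (huX : ∀ o, u o ∈ X) :
    Integrable (fun o => φ (u o)) P := by
  obtain ⟨B, hB⟩ := hx.problem.compact.exists_bound_of_continuousOn hφ
  exact Integrable.of_bound (measurable_comp_of_continuousOn hφ hu huX).aestronglyMeasurable B
    (Eventually.of_forall fun o => hB _ (huX o))

/-- The progress of one step towards a fixed point `z`, up to the noise of both oracles and their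
squared norms. -/
lemma bregman_succ_le (hx : IsRun P ν X F H GF GH μh CF CH w dw μw L γ lam ξ ξ' x)
    (hγ : ∀ k, 0 ≤ γ k) (hlam : ∀ k, 0 ≤ lam k) (hz : z ∈ X) (k : ℕ) (o : Ω) :
    bregman w dw (x (k + 1) o) z ≤ bregman w dw (x k o) z
      - γ k * (expected ν F (x k o) - expected ν F z)
      - γ k * lam k * (expected ν H (x k o) - expected ν H z + μh / 2 * ‖x k o - z‖ ^ 2)
      + (γ k * noise ν GF z (⟨x k o, hx.mem k o⟩, ξ k o)
        + γ k * lam k * noise ν GH z (⟨x k o, hx.mem k o⟩, ξ' k o)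
        + γ k ^ 2 * ‖GF (x k o) (ξ k o)‖ ^ 2 / μw
        + (γ k * lam k) ^ 2 * ‖GH (x k o) (ξ' k o)‖ ^ 2 / μw) := by
  have hX := hx.mem k o
  have h1 := (hx.iterates.step k o).bregman_le hx.generating hx.problem.convex hX hz
  have h2 := hx.problem.oracle_F.mean (x k o) hX z hz
  have h3 := hx.problem.stronglyConvex_h.2 (x k o) hX z hz _
    (hx.problem.oracle_H.mean (x k o) hX)
  have hμ := hx.generating.pos
  set gF := GF (x k o) (ξ k o)
  set gH := GH (x k o) (ξ' k o)
  have h4 : ‖γ k • (gF + lam k • gH)‖ ^ 2 / (2 * μw) ≤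
      γ k ^ 2 * ‖gF‖ ^ 2 / μw + (γ k * lam k) ^ 2 * ‖gH‖ ^ 2 / μw := by
    have h5 : ‖γ k • (gF + lam k • gH)‖ ≤ γ k * ‖gF‖ + γ k * lam k * ‖gH‖ := by
      rw [norm_smul, Real.norm_of_nonneg (hγ k), mul_assoc, ← mul_add]
      refine mul_le_mul_of_nonneg_left ((norm_add_le _ _).trans ?_) (hγ k)
      rw [norm_smul, Real.norm_of_nonneg (hlam k)]
    have h6 := pow_le_pow_left₀ (norm_nonneg _) h5 2
    rw [← add_div, div_le_div_iff₀ (by positivity) hμ]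
    nlinarith [sq_nonneg (γ k * ‖gF‖ - γ k * lam k * ‖gH‖)]
  have h5 : (γ k • (gF + lam k • gH)) (z - x k o) =
      γ k * (noise ν GF z ((⟨x k o, hX⟩ : X), ξ k o) + (∫ s, GF (x k o) s ∂ν) (z - x k o)) +
      γ k * lam k * (noise ν GH z ((⟨x k o, hX⟩ : X), ξ' k o) +
        (∫ s, GH (x k o) s ∂ν) (z - x k o)) := by
    simp only [noise, sub_add_cancel, smul_apply, add_apply, smul_eq_mul, gF, gH]
    ring
  rw [h5] at h1
  have h6 := mul_le_mul_of_nonneg_left h2 (hγ k)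
  have h7 := mul_le_mul_of_nonneg_left h3 (mul_nonneg (hγ k) (hlam k))
  linarith

end IsRun

end Run

/-! ### Convergence and rate -/

section Run

variable {E : Type*} [NormedAddCommGroup E] [NormedSpace ℝ E] [MeasurableSpace E]
  [FiniteDimensional ℝ E] [BorelSpace E]
  {S : Type*} [MeasurableSpace S] {Ω : Type*} [MeasurableSpace Ω]
  {P : Measure Ω} [IsProbabilityMeasure P] {ν : Measure S} [IsProbabilityMeasure ν]
  {X : Set E} {F H : E → S → ℝ}
  {GF GH : E → S → StrongDual ℝ E} {μh CF CH : ℝ} {w : E → ℝ} {dw : E → StrongDual ℝ E}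
  {μw L : ℝ} {γ lam : ℕ → ℝ} {ξ ξ' : ℕ → Ω → S} {x : ℕ → Ω → E} {z : E}

/-- The weighted noise and the weighted squared norms of the sampled subgradients along the
iterates have almost surely convergent series. -/
lemma IsFreshSample.ae_tendsto_oracle {ℱ : Filtration ℕ ‹MeasurableSpace Ω›} {ζ : ℕ → Ω → S}
    (hζ : IsFreshSample P ν ℱ ζ) {Φ : E → S → ℝ} {G : E → S → StrongDual ℝ E} {C : ℝ}
    (hG : IsStochasticSubgradient ν X Φ G C) (hX : IsCompact X) (z : E) {u : ℕ → Ω → X}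
    (hu : ∀ k, Measurable[ℱ k] (u k)) {c : ℕ → ℝ} (hc : Summable fun k => c k ^ 2) :
    ∀ᵐ o ∂P, (∃ l, Tendsto (fun n => ∑ k ∈ Finset.range n, c k * noise ν G z (u k o, ζ k o))
        atTop (𝓝 l)) ∧ Summable fun k => c k ^ 2 * ‖G (u k o) (ζ k o)‖ ^ 2 := by
  obtain ⟨R, hR⟩ := exists_norm_sub_le hX z
  have h1 := hζ.ae_tendsto_sum hu (hG.measurable_noise z) (hG.integral_noise z)
    (fun t => (hG.integrable_noise_sq hR t).1) (fun t => (hG.integrable_noise_sq hR t).2) hc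
  have h2 := hζ.ae_summable hu (φ := fun p => ‖G p.1 p.2‖ ^ 2) (hG.measurable.norm.pow_const 2)
    (fun p => sq_nonneg _) (fun t => hG.integrable t t.2) (fun t => hG.moment t t.2)
    (fun k => sq_nonneg (c k)) hc
  filter_upwards [h1, h2] with o h3 h4 using ⟨h3, h4⟩

lemma IsFreshSample.integral_oracle {ℱ : Filtration ℕ ‹MeasurableSpace Ω›} {ζ : ℕ → Ω → S}
    (hζ : IsFreshSample P ν ℱ ζ) {Φ : E → S → ℝ} {G : E → S → StrongDual ℝ E} {C : ℝ}
    (hG : IsStochasticSubgradient ν X Φ G C) (hX : IsCompact X) (z : E) {u : ℕ → Ω → X}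
    (hu : ∀ k, Measurable[ℱ k] (u k)) (k : ℕ) :
    (Integrable (fun o => noise ν G z (u k o, ζ k o)) P ∧
      ∫ o, noise ν G z (u k o, ζ k o) ∂P = 0) ∧
    Integrable (fun o => ‖G (u k o) (ζ k o)‖ ^ 2) P ∧
      ∫ o, ‖G (u k o) (ζ k o)‖ ^ 2 ∂P ≤ C ^ 2 := by
  obtain ⟨R, hR⟩ := exists_norm_sub_le hX z
  have hu' : Measurable (u k) := (hu k).mono (ℱ.le k) le_rfl
  refine ⟨⟨((hζ.memLp hu (hG.measurable_noise z) (fun t => (hG.integrable_noise_sq hR t).1)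
    (fun t => (hG.integrable_noise_sq hR t).2) k).1).integrable one_le_two, ?_⟩, ?_⟩
  · have := integral_mul_centered_eq_zero (B := fun _ => 1) hu' measurable_const
      (hζ.measurable_top k) (hζ.law k)
      (hζ.indepFun ((hu k).prodMk (@measurable_const ℝ Ω _ (ℱ k) 1)))
      (hG.measurable_noise z) (hG.integral_noise z)
    simpa using this
  · exact integrable_comp_sample (φ := fun p => ‖G p.1 p.2‖ ^ 2) hu' (hζ.measurable_top k)
      (hζ.law k) (hζ.indepFun (hu k)) (hG.measurable.norm.pow_const 2)
      (fun p => sq_nonneg _) (fun t => hG.integrable t t.2) (fun t => hG.moment t t.2)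

namespace IsRun

/-- Almost sure convergence of the iterates: in terms of the Bregman distance to `z`, the strong
convexity of `h` contracts by a factor `1 - c * γ k * lam k`, while the bias is
`γ k * lam k * o(1)` by `exists_regularized_ge`. -/
lemma ae_tendsto (hx : IsRun P ν X F H GF GH μh CF CH w dw μw L γ lam ξ ξ' x)
    (hL : 0 < L) (hz : z ∈ bilevelSolutionSet X (expected ν F) (expected ν H))
    (hγ : ∀ k, 0 ≤ γ k) (hlam : ∀ k, 0 ≤ lam k) (hγ2 : Summable fun k => γ k ^ 2)
    (hlam0 : Tendsto lam atTop (𝓝 0))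
    (hsum : Tendsto (fun n => ∑ k ∈ Finset.range n, γ k * lam k) atTop atTop) :
    ∀ᵐ o ∂P, Tendsto (fun k => x k o) atTop (𝓝 z) := by
  have hzX : z ∈ X := hz.1.1
  have hf := hx.problem.oracle_F.continuousOn_expected
  have hh := hx.problem.oracle_H.continuousOn_expected
  have hμh := hx.problem.stronglyConvex_h.1
  have hμw := hx.generating.pos
  have hγ0 : Tendsto γ atTop (𝓝 0) := by
    have := hγ2.tendsto_atTop_zero.sqrt
    simpa [Real.sqrt_sq (hγ _)] using this
  have hγl2 : Summable fun k => (γ k * lam k) ^ 2 := by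
    refine hγ2.of_norm_bounded_eventually_nat ?_
    filter_upwards [hlam0.eventually (ge_mem_nhds one_pos)] with k hk
    rw [Real.norm_of_nonneg (sq_nonneg _), mul_pow]
    exact mul_le_of_le_one_right (sq_nonneg _) (pow_le_one₀ (hlam k) hk)
  filter_upwards [hx.fresh_left.ae_tendsto_oracle hx.problem.oracle_F hx.problem.compact z
    hx.measurable_subtype hγ2, hx.fresh_right.ae_tendsto_oracle hx.problem.oracle_H
    hx.problem.compact z hx.measurable_subtype hγl2] with o hoF hoH
  obtain ⟨⟨l₁, hl₁⟩, hs₁⟩ := hoF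
  obtain ⟨⟨l₂, hl₂⟩, hs₂⟩ := hoH
  have hs₁' := (hs₁.div_const μw).hasSum.tendsto_sum_nat
  have hs₂' := (hs₂.div_const μw).hasSum.tendsto_sum_nat
  have he := ((hl₁.add hl₂).add hs₁').add hs₂'
  simp only [← Finset.sum_add_distrib] at he
  have hc : 0 < μh / L := div_pos hμh hL
  have hy : Tendsto (fun k => bregman w dw (x k o) z) atTop (𝓝 0) := by
    refine tendsto_zero_of_recursion (a := fun k => μh / L * (γ k * lam k))
      (fun k => hx.generating.bregman_nonneg (hx.mem k o) hzX)
      (fun k => mul_nonneg hc.le (mul_nonneg (hγ k) (hlam k))) ?_ ?_ he fun ε hε => ?_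
    · simpa using (hγ0.mul hlam0).const_mul (μh / L)
    · simp only [← Finset.mul_sum]
      exact hsum.const_mul_atTop hc
    · obtain ⟨Λ, hΛ, hreg⟩ := exists_regularized_ge hx.problem.compact hf hh hz (mul_pos hc hε)
      filter_upwards [hlam0.eventually (ge_mem_nhds hΛ)] with k hk
      have h1 := hx.bregman_succ_le hγ hlam hzX k o
      have h2 := mul_le_mul_of_nonneg_left (hreg (lam k) (hlam k) hk _ (hx.mem k o)) (hγ k)
      have h3 : μh / L * bregman w dw (x k o) z ≤ μh / 2 * ‖x k o - z‖ ^ 2 := by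
        have h4 := mul_le_mul_of_nonneg_left (hx.generating.bregman_le (hx.mem k o) hzX) hc.le
        have h5 : μh / L * (L / 2 * ‖x k o - z‖ ^ 2) = μh / 2 * ‖x k o - z‖ ^ 2 := by
          field_simp
        linarith
      have h6 := mul_le_mul_of_nonneg_left h3 (mul_nonneg (hγ k) (hlam k))
      nlinarith
  rw [tendsto_iff_norm_sub_tendsto_zero]
  have h1 : Tendsto (fun k => 2 / μw * bregman w dw (x k o) z) atTop (𝓝 0) := by
    simpa using hy.const_mul (2 / μw)
  have h2 : Tendsto (fun k => ‖x k o - z‖ ^ 2) atTop (𝓝 0) := by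
    refine squeeze_zero (fun k => sq_nonneg _) (fun k => ?_) h1
    rw [div_mul_eq_mul_div, le_div_iff₀ hμw]
    linarith [hx.generating.le_bregman (hx.mem k o) hzX]
  simpa [Real.sqrt_sq (norm_nonneg _)] using h2.sqrt

/-- The telescoping inequality in expectation, where the strong convexity of `h` is dropped and
`h` is bounded below on `X`. -/
lemma exists_integral_gap_le (hx : IsRun P ν X F H GF GH μh CF CH w dw μw L γ lam ξ ξ' x)
    (hL : 0 < L) (hz : z ∈ X) (hγ : ∀ k, 0 ≤ γ k) (hlam : ∀ k, 0 ≤ lam k)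
    {l : ℝ} (hlaml : ∀ k, lam k ≤ l) :
    ∃ B C M : ℝ, 0 ≤ B ∧ 0 ≤ C ∧ (∀ k, 0 ≤ ∫ o, bregman w dw (x k o) z ∂P) ∧
      (∀ k, ∫ o, bregman w dw (x k o) z ∂P ≤ M) ∧
      ∀ k, γ k * ∫ o, (expected ν F (x k o) - expected ν F z) ∂P ≤
        (∫ o, bregman w dw (x k o) z ∂P) - (∫ o, bregman w dw (x (k + 1) o) z ∂P) +
        γ k * lam k * B + γ k ^ 2 * C := by
  have hf := hx.problem.oracle_F.continuousOn_expected
  have hh := hx.problem.oracle_H.continuousOn_expected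
  have hμh := hx.problem.stronglyConvex_h.1
  have hμw := hx.generating.pos
  obtain ⟨R, hR⟩ := exists_norm_sub_le hx.problem.compact z
  obtain ⟨B, hB⟩ := hx.problem.compact.exists_bound_of_continuousOn hh
  have hB0 : 0 ≤ B := (norm_nonneg _).trans (hB z hz)
  have hDnn : ∀ k o, 0 ≤ bregman w dw (x k o) z := fun k o =>
    hx.generating.bregman_nonneg (hx.mem k o) hz
  have hDle : ∀ k o, bregman w dw (x k o) z ≤ L / 2 * R ^ 2 := fun k o => by
    refine (hx.generating.bregman_le (hx.mem k o) hz).trans ?_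
    rw [norm_sub_rev]
    gcongr
    exact hR _ (hx.mem k o)
  have hDI : ∀ k, Integrable (fun o => bregman w dw (x k o) z) P := fun k =>
    Integrable.of_bound (hx.generating.measurable_bregman hx.problem.convex (hx.measurable k)
      (hx.mem k) hz).aestronglyMeasurable (L / 2 * R ^ 2) (Eventually.of_forall fun o => by
        rw [Real.norm_of_nonneg (hDnn k o)]; exact hDle k o)
  refine ⟨2 * B, (CF ^ 2 + l ^ 2 * CH ^ 2) / μw, L / 2 * R ^ 2, by positivity, by positivity,
    fun k => integral_nonneg (hDnn k), fun k => ?_, fun k => ?_⟩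
  · have := integral_mono (hDI k) (integrable_const _) (hDle k)
    simpa using this
  · obtain ⟨⟨iF, eF⟩, jF, bF⟩ := hx.fresh_left.integral_oracle hx.problem.oracle_F
      hx.problem.compact z hx.measurable_subtype k
    obtain ⟨⟨iH, eH⟩, jH, bH⟩ := hx.fresh_right.integral_oracle hx.problem.oracle_H
      hx.problem.compact z hx.measurable_subtype k
    have hfI : Integrable (fun o => expected ν F (x k o) - expected ν F z) P :=
      (hx.integrable_comp hf (hx.measurable k) (hx.mem k)).sub (integrable_const _)
    have hpt : ∀ o, γ k * (expected ν F (x k o) - expected ν F z) ≤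
        (bregman w dw (x k o) z - bregman w dw (x (k + 1) o) z + γ k * lam k * (2 * B)) +
        (γ k * noise ν GF z (⟨x k o, hx.mem k o⟩, ξ k o)
        + γ k * lam k * noise ν GH z (⟨x k o, hx.mem k o⟩, ξ' k o)) +
        (γ k ^ 2 / μw * ‖GF (x k o) (ξ k o)‖ ^ 2
        + (γ k * lam k) ^ 2 / μw * ‖GH (x k o) (ξ' k o)‖ ^ 2) := by
      intro o
      have h1 := hx.bregman_succ_le hγ hlam hz k o
      have h2 : -(2 * B) ≤ expected ν H (x k o) - expected ν H z +
          μh / 2 * ‖x k o - z‖ ^ 2 := by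
        have h3 := (abs_le.1 (hB _ (hx.mem k o))).1
        have h4 := (abs_le.1 (hB z hz)).2
        have h5 : 0 ≤ μh / 2 * ‖x k o - z‖ ^ 2 := by positivity
        linarith
      have h6 := mul_le_mul_of_nonneg_left h2 (mul_nonneg (hγ k) (hlam k))
      rw [div_mul_eq_mul_div, div_mul_eq_mul_div]
      linarith
    have I0 : Integrable (fun o => bregman w dw (x k o) z - bregman w dw (x (k + 1) o) z) P :=
      (hDI k).sub (hDI (k + 1))
    have I1 : Integrable (fun o => bregman w dw (x k o) z - bregman w dw (x (k + 1) o) z +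
        γ k * lam k * (2 * B)) P := I0.add (integrable_const _)
    have I2 : Integrable (fun o => γ k * noise ν GF z (⟨x k o, hx.mem k o⟩, ξ k o)
        + γ k * lam k * noise ν GH z (⟨x k o, hx.mem k o⟩, ξ' k o)) P :=
      (iF.const_mul _).add (iH.const_mul _)
    have I3 : Integrable (fun o => γ k ^ 2 / μw * ‖GF (x k o) (ξ k o)‖ ^ 2
        + (γ k * lam k) ^ 2 / μw * ‖GH (x k o) (ξ' k o)‖ ^ 2) P :=
      (jF.const_mul _).add (jH.const_mul _)
    have hI := integral_mono (hfI.const_mul (γ k)) ((I1.add I2).add I3) hpt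
    change _ ≤ ∫ o, (_ + _ : ℝ) ∂P at hI
    rw [integral_add (I1.add I2) I3] at hI
    change _ ≤ (∫ o, (_ + _ : ℝ) ∂P) + _ at hI
    rw [integral_add I1 I2,
      integral_add I0 (integrable_const _),
      integral_sub (hDI k) (hDI (k + 1)), integral_add (iF.const_mul _) (iH.const_mul _),
      integral_add (jF.const_mul _) (jH.const_mul _)] at hI
    simp only [integral_const_mul, eF, eH, mul_zero, add_zero, integral_const, probReal_univ,
      smul_eq_mul, one_mul] at hI
    have hlsq : lam k ^ 2 ≤ l ^ 2 := pow_le_pow_left₀ (hlam k) (hlaml k) 2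
    have h7 : γ k ^ 2 / μw * ∫ o, ‖GF (x k o) (ξ k o)‖ ^ 2 ∂P ≤ γ k ^ 2 / μw * CF ^ 2 :=
      mul_le_mul_of_nonneg_left bF (by positivity)
    have h8 : (γ k * lam k) ^ 2 / μw * ∫ o, ‖GH (x k o) (ξ' k o)‖ ^ 2 ∂P ≤
        γ k ^ 2 / μw * (l ^ 2 * CH ^ 2) :=
      calc (γ k * lam k) ^ 2 / μw * ∫ o, ‖GH (x k o) (ξ' k o)‖ ^ 2 ∂P
          ≤ (γ k * lam k) ^ 2 / μw * CH ^ 2 := mul_le_mul_of_nonneg_left bH (by positivity)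
        _ = γ k ^ 2 / μw * (lam k ^ 2 * CH ^ 2) := by ring
        _ ≤ _ := by gcongr
    have h9 : γ k ^ 2 * ((CF ^ 2 + l ^ 2 * CH ^ 2) / μw) =
        γ k ^ 2 / μw * CF ^ 2 + γ k ^ 2 / μw * (l ^ 2 * CH ^ 2) := by ring
    linarith

/-- By convexity the expected gap of the average is at most the average of the expected gaps. -/
lemma sum_mul_integral_averagedIterate_le
    (hx : IsRun P ν X F H GF GH μh CF CH w dw μw L γ lam ξ ξ' x)
    (hγ : ∀ k, 0 < γ k) (r : ℝ) (z : E) (n : ℕ) :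
    (∑ k ∈ Finset.range (n + 1), γ k ^ r) *
        ∫ o, (expected ν F (averagedIterate γ r (fun k => x k o) n) - expected ν F z) ∂P ≤
      ∑ k ∈ Finset.range (n + 1),
        γ k ^ r * ∫ o, (expected ν F (x k o) - expected ν F z) ∂P := by
  have hf := hx.problem.oracle_F.continuousOn_expected
  have hpos : 0 < ∑ k ∈ Finset.range (n + 1), γ k ^ r :=
    Finset.sum_pos (fun k _ => Real.rpow_pos_of_pos (hγ k) r) (by simp)
  have hI : ∀ k, Integrable (fun o => γ k ^ r * (expected ν F (x k o) - expected ν F z)) P :=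
    fun k => ((hx.integrable_comp hf (hx.measurable k) (hx.mem k)).sub
      (integrable_const _)).const_mul _
  simp only [← integral_const_mul]
  rw [← integral_finsetSum _ fun k _ => hI k]
  refine integral_mono (((hx.integrable_comp hf (hx.measurable_averagedIterate r n)
    (hx.averagedIterate_mem hγ r n)).sub (integrable_const _)).const_mul _)
    (integrable_finsetSum _ fun k _ => hI k) fun o => ?_
  have h1 := hx.problem.convex_f.map_centerMass_le (t := Finset.range (n + 1))
    (w := fun k => γ k ^ r) (p := fun k => x k o)
    (fun k _ => (Real.rpow_pos_of_pos (hγ k) r).le) hpos fun k _ => hx.mem k o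
  rw [← averagedIterate_eq_centerMass hγ, Finset.centerMass, smul_eq_mul, inv_mul_eq_div,
    le_div_iff₀' hpos] at h1
  simp only [mul_sub, Finset.sum_sub_distrib, ← Finset.sum_mul]
  simp only [Function.comp_apply, smul_eq_mul] at h1
  linarith

end IsRun

end Run

end IRSMD

end

theorem theorem5p1
    {E : Type*} [NormedAddCommGroup E] [NormedSpace ℝ E] [FiniteDimensional ℝ E]
    [MeasurableSpace E] [BorelSpace E]
    {d : ℕ} {Ω : Type*} [MeasurableSpace Ω]
    (P : Measure Ω) [IsProbabilityMeasure P]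
    (ν : Measure (EuclideanSpace ℝ (Fin d))) [IsProbabilityMeasure ν]
    (X : Set E) (F H : E → EuclideanSpace ℝ (Fin d) → ℝ)
    (GF GH : E → EuclideanSpace ℝ (Fin d) → StrongDual ℝ E) (μh CF CH : ℝ)
    (hprob : IRSMD.ProblemAssumptions ν X F H GF GH μh CF CH)
    (w : E → ℝ) (dw : E → StrongDual ℝ E) (μw Lw : ℝ)
    (hw : IRSMD.IsDistanceGenerating X w dw μw Lw)
    (δ r γ₀ lam₀ : ℝ) (hδ : 0 < δ) (hδ' : δ < 1 / 2) (hr : r < 1)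
    (hγ₀ : 0 < γ₀) (hlam₀ : 0 < lam₀) (hprod : γ₀ * lam₀ ≤ Lw / μh)
    (γ lam : ℕ → ℝ)
    (hγ : ∀ k : ℕ, γ k = γ₀ / ((k : ℝ) + 1) ^ (1 / 2 + δ / 2 : ℝ))
    (hlam : ∀ k : ℕ, lam k = lam₀ / ((k : ℝ) + 1) ^ (1 / 2 - δ : ℝ))
    (ξ ξ' : ℕ → Ω → EuclideanSpace ℝ (Fin d)) (x : ℕ → Ω → E)
    (hsample : IRSMD.SamplingAssumptions P ν ξ ξ' (x 0))
    (hx : IRSMD.IsIterates X w dw GF GH γ lam ξ ξ' x)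
    (xbar : ℕ → Ω → E)
    (hxbar : ∀ N o, xbar N o = IRSMD.averagedIterate γ r (fun k => x k o) N) :
    ∃ xh : E,
      IRSMD.bilevelSolutionSet X (IRSMD.expected ν F) (IRSMD.expected ν H) = {xh} ∧
      (∀ᵐ o ∂P, Tendsto (fun N => xbar N o) atTop (𝓝 xh)) ∧
      ((∀ N, Integrable (fun o => ‖xbar N o - xh‖) P) ∧
        Tendsto (fun N => ∫ o, ‖xbar (N + 1) o - xh‖ ∂P) atTop (𝓝 0)) ∧
      ((∀ N, Integrable (fun o => IRSMD.expected ν F (xbar N o)) P) ∧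
        (fun N : ℕ => (∫ o, IRSMD.expected ν F (xbar N o) ∂P)
            - sInf (IRSMD.expected ν F '' X))
          =O[atTop] fun N : ℕ => 1 / (N : ℝ) ^ (1 / 2 - δ : ℝ)) := by
  -- Enlarging the smoothness constant makes it positive even if `X` is a single point.
  have hw' : IRSMD.IsDistanceGenerating X w dw μw (max Lw 1) :=
    ⟨hw.pos, hw.hasGradient, hw.lower, fun x hx y hy => (hw.upper x hx y hy).trans (by
      gcongr; exact le_max_left _ _)⟩
  have hL : 0 < max Lw 1 := lt_max_of_lt_right one_pos
  have hrun : IRSMD.IsRun P ν X F H GF GH μh CF CH w dw μw (max Lw 1) γ lam ξ ξ' x :=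
    ⟨hprob, hw', hsample, hx⟩
  obtain rfl : xbar = fun N o => IRSMD.averagedIterate γ r (fun k => x k o) N := by
    ext N o; exact hxbar N o
  have hkpos : ∀ k : ℕ, (0 : ℝ) < (k : ℝ) + 1 := fun k => by positivity
  have hγ' : ∀ k : ℕ, γ k = γ₀ * ((k : ℝ) + 1) ^ (-(1 / 2 + δ / 2)) := fun k => by
    rw [hγ, Real.rpow_neg (hkpos k).le, div_eq_mul_inv]
  have hlam' : ∀ k : ℕ, lam k = lam₀ * ((k : ℝ) + 1) ^ (-(1 / 2 - δ)) := fun k => by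
    rw [hlam, Real.rpow_neg (hkpos k).le, div_eq_mul_inv]
  have hγpos : ∀ k, 0 < γ k := fun k => by
    rw [hγ']; exact mul_pos hγ₀ (Real.rpow_pos_of_pos (hkpos k) _)
  have hlampos : ∀ k, 0 < lam k := fun k => by
    rw [hlam']; exact mul_pos hlam₀ (Real.rpow_pos_of_pos (hkpos k) _)
  have hlamle : ∀ k, lam k ≤ lam₀ := fun k => by
    rw [hlam']
    exact mul_le_of_le_one_right hlam₀.le
      (Real.rpow_le_one_of_one_le_of_nonpos (by simp) (by linarith))
  have hcast : Tendsto (fun k : ℕ => (k : ℝ) + 1) atTop atTop :=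
    tendsto_atTop_add_const_right _ _ tendsto_natCast_atTop_atTop
  have hlam0 : Tendsto lam atTop (𝓝 0) := by
    have h1 := ((tendsto_rpow_neg_atTop (show 0 < 1 / 2 - δ by linarith)).comp hcast).const_mul lam₀
    rw [mul_zero] at h1
    exact h1.congr fun k => (hlam' k).symm
  have hγ2 : Summable fun k => γ k ^ 2 := by
    have h1 : Summable fun k : ℕ => ((k : ℝ) + 1) ^ (-(1 + δ)) := by
      have := (summable_nat_add_iff 1).2 (Real.summable_nat_rpow.2 (show -(1 + δ) < -1 by linarith))
      simpa using this
    refine (h1.mul_left (γ₀ ^ 2)).congr fun k => ?_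
    rw [hγ', mul_pow, ← Real.rpow_natCast (_ ^ _) 2, ← Real.rpow_mul (hkpos k).le]
    congr 2
    push_cast; ring
  have hsum : Tendsto (fun n => ∑ k ∈ Finset.range n, γ k * lam k) atTop atTop := by
    refine ((IRSMD.tendsto_sum_rpow_atTop (show 1 - δ / 2 < 1 by linarith)).const_mul_atTop
      (mul_pos hγ₀ hlam₀)).congr fun n => ?_
    rw [Finset.mul_sum]
    refine Finset.sum_congr rfl fun k _ => ?_
    rw [hγ', hlam', mul_mul_mul_comm, ← Real.rpow_add (hkpos k)]
    congr 2
    ring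
  have hsumr : Tendsto (fun n => ∑ k ∈ Finset.range n, γ k ^ r) atTop atTop := by
    have hexp : (1 / 2 + δ / 2) * r < 1 := by nlinarith
    refine ((IRSMD.tendsto_sum_rpow_atTop hexp).const_mul_atTop
      (Real.rpow_pos_of_pos hγ₀ r)).congr fun n => ?_
    rw [Finset.mul_sum]
    refine Finset.sum_congr rfl fun k _ => ?_
    rw [hγ', Real.mul_rpow hγ₀.le (Real.rpow_nonneg (hkpos k).le _), ← Real.rpow_mul (hkpos k).le,
      neg_mul]
  have hf := hprob.oracle_F.continuousOn_expected
  have hh := hprob.oracle_H.continuousOn_expected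
  obtain ⟨z, hz⟩ := IRSMD.exists_bilevelSolutionSet_eq_singleton hprob.nonempty hprob.compact hf
    hprob.convex_f hh hprob.subdifferentiable_h hprob.stronglyConvex_h
  have hzmem : z ∈ IRSMD.bilevelSolutionSet X (IRSMD.expected ν F) (IRSMD.expected ν H) := by
    rw [hz]; rfl
  have hzX : z ∈ X := hzmem.1.1
  have hzmin : ∀ y ∈ X, IRSMD.expected ν F z ≤ IRSMD.expected ν F y := fun y hy => hzmem.1.2 hy
  have hae : ∀ᵐ o ∂P, Tendsto (fun N => IRSMD.averagedIterate γ r (fun k => x k o) N)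
      atTop (𝓝 z) := by
    filter_upwards [hrun.ae_tendsto hL hzmem (fun k => (hγpos k).le) (fun k => (hlampos k).le)
      hγ2 hlam0 hsum] with o ho
    exact IRSMD.tendsto_averagedIterate hγpos hsumr ho
  have hnI : ∀ N, Integrable
      (fun o => ‖IRSMD.averagedIterate γ r (fun k => x k o) N - z‖) P := fun N =>
    hrun.integrable_comp (φ := fun y => ‖y - z‖)
      (continuous_id.sub continuous_const).norm.continuousOn
      (hrun.measurable_averagedIterate r N) (hrun.averagedIterate_mem hγpos r N)
  have hfI : ∀ N, Integrable
      (fun o => IRSMD.expected ν F (IRSMD.averagedIterate γ r (fun k => x k o) N)) P := fun N =>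
    hrun.integrable_comp hf (hrun.measurable_averagedIterate r N)
      (hrun.averagedIterate_mem hγpos r N)
  refine ⟨z, hz, hae, ⟨hnI, ?_⟩, hfI, ?_⟩
  · obtain ⟨R, hR⟩ := IRSMD.exists_norm_sub_le hprob.compact z
    have h1 := tendsto_integral_of_dominated_convergence (μ := P)
      (F := fun N o => ‖IRSMD.averagedIterate γ r (fun k => x k o) N - z‖) (f := fun _ => 0)
      (fun _ => R) (fun N => (hnI N).aestronglyMeasurable) (integrable_const _)
      (fun N => Eventually.of_forall fun o => by
        rw [norm_norm, norm_sub_rev]; exact hR _ (hrun.averagedIterate_mem hγpos r N o))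
      (hae.mono fun o ho => tendsto_iff_norm_sub_tendsto_zero.1 ho)
    rw [integral_zero] at h1
    exact (tendsto_add_atTop_iff_nat 1).2 h1
  · obtain ⟨B, C, M, hB, hC, hd0, hdM, hgap⟩ := hrun.exists_integral_gap_le hL hzX
      (fun k => (hγpos k).le) (fun k => (hlampos k).le) hlamle
    obtain ⟨K, hK⟩ := IRSMD.exists_sum_weight_mul_le hγ₀ hlam₀ (by linarith) (by linarith)
      (by linarith) (by linarith) hr hB hC hγ' hlam' hd0 hdM hgap
    -- The infimum is attained at `z`, so it is a genuine minimum.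
    have hinf : sInf (IRSMD.expected ν F '' X) = IRSMD.expected ν F z :=
      IsLeast.csInf_eq ⟨⟨z, hzX, rfl⟩, by rintro _ ⟨y, hy, rfl⟩; exact hzmin y hy⟩
    rw [hinf]
    refine IsBigO.of_bound |K| ((eventually_gt_atTop 0).mono fun N hN => ?_)
    have hS : 0 < ∑ k ∈ Finset.range (N + 1), γ k ^ r :=
      Finset.sum_pos (fun k _ => Real.rpow_pos_of_pos (hγpos k) r) (by simp)
    have h1 := (hrun.sum_mul_integral_averagedIterate_le hγpos r z N).trans (hK N)
    rw [mul_comm, mul_le_mul_iff_left₀ hS, integral_sub (hfI N) (integrable_const _)] at h1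
    simp only [integral_const, probReal_univ, smul_eq_mul, one_mul] at h1
    have h2 : 0 ≤ (∫ o, IRSMD.expected ν F (IRSMD.averagedIterate γ r (fun k => x k o) N) ∂P) -
        IRSMD.expected ν F z := by
      have := integral_mono (integrable_const (IRSMD.expected ν F z)) (hfI N)
        fun o => hzmin _ (hrun.averagedIterate_mem hγpos r N o)
      simp only [integral_const, probReal_univ, smul_eq_mul, one_mul] at this
      linarith
    have hN0 : (0 : ℝ) < N := Nat.cast_pos.2 hN
    have h3 : ((N : ℝ) + 1) ^ (-(1 / 2 - δ)) ≤ 1 / (N : ℝ) ^ (1 / 2 - δ) := by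
      rw [one_div ((N : ℝ) ^ _), ← Real.rpow_neg hN0.le]
      exact Real.rpow_le_rpow_of_nonpos hN0 (by linarith) (by linarith)
    rw [Real.norm_of_nonneg h2, Real.norm_of_nonneg (by positivity)]
    calc _ ≤ K * ((N : ℝ) + 1) ^ (-(1 / 2 - δ)) := h1
      _ ≤ |K| * ((N : ℝ) + 1) ^ (-(1 / 2 - δ)) := by gcongr; exact le_abs_self K
      _ ≤ _ := by gcongr
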